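/- Setting. Let $d\ge 1$, $L>0$, $N\geq 2$ an even integer, $\mathbf j_*\in\mathbb Z^d\setminus\{0\}$ and $\phi_{\mathbf j_*}>0$. Put $k_{\mathbf j}=\frac{2\pi}{L}\mathbf j$ for $\mathbf j\in\mathbb Z^d$, let $a_{\mathbf j},a_{\mathbf j}^*$ be the bosonic annihilation and creation operators of the modes, and let $\mathcal F^N$ be the $N$-particle subspace of the bosonic Fock space. On $\mathcal F^N$ let $$W=\phi_{\mathbf j_*}\frac{a_{0}^*a_{0}^*a_{\mathbf j_*}a_{-\mathbf j_*}}{N},\qquad W^*=\phi_{\mathbf j_*}\frac{a_{0}a_{0}a^*_{\mathbf j_*}a^*_{-\mathbf j_*}}{N},$$ $$H=\sum_{\mathbf j\ne\pm\mathbf j_*}k_{\mathbf j}^2a^*_{\mathbf j}a_{\mathbf j}+\Big(k_{\mathbf j_*}^2+\phi_{\mathbf j_*}\frac{a_0^*a_0}{N}\Big)\big(a^*_{\mathbf j_*}a_{\mathbf j_*}+a^*_{-\mathbf j_*}a_{-\mathbf j_*}\big)+W+W^*,$$ and let $$\epsilon=\frac{k_{\mathbf j_*}^2}{\phi_{\mathbf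 j_*}},\qquad E^{Bog}=-\Big[k_{\mathbf j_*}^2+\phi_{\mathbf j_*}-\sqrt{(k_{\mathbf j_*}^2)^2+2\phi_{\mathbf j_*}k_{\mathbf j_*}^2}\Big].$$ For even $i$ with $0\le i\le N-2$ let $Q^{(i,i+1)}$ and $Q^{(>i+1)}$ be the orthogonal projections of $\mathcal F^N$ onto the vectors with $N-i$ or $N-i-1$ particles, respectively with fewer than $N-i-1$ particles, in the modes $\pm\mathbf j_*$. For real $z$ put $$R_{i,i}(z)=Q^{(i,i+1)}\frac{1}{Q^{(i,i+1)}(H-z)Q^{(i,i+1)}}Q^{(i,i+1)},\quad W_{i,i'}=Q^{(i,i+1)}WQ^{(i',i'+1)},\quad W^*_{i,i'}=Q^{(i,i+1)}W^*Q^{(i',i'+1)}.$$ The Feshbach–Schur Hamiltonians are defined by $K^{(-2)}(z)=H-z$ and, with $P=Q^{(>i+1)}$, $\overline P=Q^{(i,i+1)}$, $K=K^{(i-2)}(z)$, $$K^{(i)}(z)=PKP-PK\overline P\,\frac{1}{\overline PK\overline P}\,\overline PKP .$$ The effective interactions are $\Gamma_{2,2}(z)=W_{2,0}R_{0,0}(z)W^*_{0,2}$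 and, for even $4\le i\le N-2$, $$\Gamma_{i,i}(z)=W_{i,i-2}R_{i-2,i-2}(z)\sum_{l=0}^\infty\big[\Gamma_{i-2,i-2}(z)R_{i-2,i-2}(z)\big]^{l}\,W^*_{i-2,i}.$$ Put $\check\Gamma_{0,0}(z)=1$ and $\check\Gamma_{i,i}(z)=\sum_{l=0}^\infty\big[R_{i,i}(z)^{1/2}\Gamma_{i,i}(z)R_{i,i}(z)^{1/2}\big]^l$ for even $2\le i\le N-2$. Given a number $a_\epsilon$, define $X_0=1$ and $$X_{2j+2}=1-\frac{1}{4\Big(1+a_\epsilon-\frac{2b_\epsilon}{N-2j-1}-\frac{1-c_\epsilon}{(N-2j-1)^2}\Big)X_{2j}},$$ where, with $\delta=1+\sqrt\epsilon$ and $\chi_{[0,2)}$ the characteristic function of $[0,2)$, $b_\epsilon=(1+\epsilon)\,\delta\,\chi_{[0,2)}(\delta)\sqrt{\epsilon^2+2\epsilon}$ and $c_\epsilon=-(1-\delta^2\chi_{[0,2)}(\delta))(\epsilon^2+2\epsilon)$. Theorem. Let $\nu>\frac{11}{8}$. There are a function $a_\epsilon=2\epsilon+\mathcal O(\epsilon^\nu)$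 and a function $r(\epsilon)=o(1)$ (both as $\epsilon\to0^+$) and an $\epsilon_0>0$, all depending on $\nu$ only, such that the following holds for all $d,L,N,\mathbf j_*,\phi_{\mathbf j_*}$ as above with $\epsilon\le\epsilon_0$ and $\frac1N\le\epsilon^\nu$, and all real $$z\le E^{Bog}+\sqrt{\epsilon}\,\phi_{\mathbf j_*}\sqrt{\epsilon^2+2\epsilon}.$$ One has $z<0$, and for every even $i$ with $0\le i\le N-2$: 1. $Q^{(i,i+1)}(H-z)Q^{(i,i+1)}$ is bounded invertible on $Q^{(i,i+1)}\mathcal F^N$ and $R_{i,i}(z)\ge0$. 2. $K^{(i)}(z)$ is well defined, i.e. $Q^{(i,i+1)}K^{(i-2)}(z)Q^{(i,i+1)}$ is bounded invertible on $Q^{(i,i+1)}\mathcal F^N$; and $K^{(i)}(z)$ is self-adjoint on the domain of $Q^{(>i+1)}(H-z)Q^{(>i+1)}$. 3. For $i=0$, $$K^{(0)}(z)=Q^{(>1)}(H-z)Q^{(>1)}-Q^{(>1)}W\,R_{0,0}(z)\,W^*Q^{(>1)}.$$ For $i\ge2$ the series $\sum_l[\Gamma_{i,i}(z)R_{i,i}(z)]^l$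 and $\sum_l[R_{i,i}(z)^{1/2}\Gamma_{i,i}(z)R_{i,i}(z)^{1/2}]^l$ are summable in operator norm and $$K^{(i)}(z)=Q^{(>i+1)}(H-z)Q^{(>i+1)}-Q^{(>i+1)}W\,R_{i,i}(z)\sum_{l=0}^\infty\big[\Gamma_{i,i}(z)R_{i,i}(z)\big]^{l}\,W^*Q^{(>i+1)}.$$ 4. For $i\ge4$, $$\Gamma_{i,i}(z)=W_{i,i-2}R_{i-2,i-2}(z)^{1/2}\sum_{l=0}^\infty\big[R_{i-2,i-2}(z)^{1/2}\Gamma_{i-2,i-2}(z)R_{i-2,i-2}(z)^{1/2}\big]^{l}R_{i-2,i-2}(z)^{1/2}W^*_{i-2,i}.$$ 5. $X_i>0$, $\ \|\check\Gamma_{i,i}(z)\|\le 1/X_i$, and $X_i\ge\frac14+r(\epsilon)$; so $\|\check\Gamma_{i,i}(z)\|$ is bounded uniformly. -/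

import Mathlib

open Filter Topology Asymptotics
open scoped ENNReal NNReal

noncomputable section

namespace Bogoliubov

/-! ## Bosonic Fock space in the occupation number representation -/

/-- Labels `j ∈ ℤ^d` of the momentum modes `k_j = (2π/L) j`. -/
abbrev Mode (d : ℕ) := Fin d → ℤ

/-- Occupation numbers `(n_j)_j`, of finite total number. -/
abbrev Occ (d : ℕ) := Mode d →₀ ℕ

/-- Arbitrary families of coefficients with respect to the orthonormal basis of product states
`φ_n = ∏_j (n_j!)^{-1/2} (a_j^*)^{n_j} Ω`. The bosonic Fock space over `L²` of the periodic box is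
the space of square-summable amplitudes. -/
abbrev Amp (d : ℕ) := Occ d → ℂ

/-- The occupation numbers of states with exactly `N` particles. -/
abbrev Config (d N : ℕ) := {n : Occ d // n.degree = N}

/-- The `N`-particle space `𝓕^N`. -/
abbrev FockN (d N : ℕ) := lp (fun _ : Config d N => ℂ) 2

/-- Annihilation operator: `a_j φ_n = √(n_j) φ_{n - e_j}`, read on amplitudes. -/
def ann {d : ℕ} (j : Mode d) : Amp d →ₗ[ℂ] Amp d where
  toFun ψ := fun n => (Real.sqrt ((n j : ℝ) + 1) : ℂ) * ψ (n + Finsupp.single j 1)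
  map_add' ψ χ := by funext n; simp [mul_add]
  map_smul' c ψ := by funext n; simp; ring

/-- Creation operator: `a_j^* φ_n = √(n_j + 1) φ_{n + e_j}`, read on amplitudes
(the factor vanishes when `n_j = 0`, the only case in which the subtraction is truncated). -/
def cre {d : ℕ} (j : Mode d) : Amp d →ₗ[ℂ] Amp d where
  toFun ψ := fun n => (Real.sqrt (n j : ℝ) : ℂ) * ψ (n - Finsupp.single j 1)
  map_add' ψ χ := by funext n; simp [mul_add]
  map_smul' c ψ := by funext n; simp; ring

/-- Extension by zero of an `N`-particle coefficient family to all occupation numbers. -/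
def extend (d N : ℕ) : (Config d N → ℂ) →ₗ[ℂ] Amp d where
  toFun ψ := fun n => if h : n.degree = N then ψ ⟨n, h⟩ else 0
  map_add' ψ χ := by funext n; by_cases h : n.degree = N <;> simp [h]
  map_smul' c ψ := by funext n; by_cases h : n.degree = N <;> simp [h]

/-- The action of an operator on amplitudes, restricted to the `N`-particle sector. -/
def sectorMap {d : ℕ} (N : ℕ) (T : Amp d →ₗ[ℂ] Amp d) :
    (Config d N → ℂ) →ₗ[ℂ] (Config d N → ℂ) where
  toFun ψ := fun n => T (extend d N ψ) n.1
  map_add' ψ χ := by funext n; simp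
  map_smul' c ψ := by funext n; simp

/-- The operator on `𝓕^N` given by an operator on amplitudes, on its maximal domain
`{ψ ∈ 𝓕^N | T ψ ∈ 𝓕^N}`. -/
def sectorOp {d : ℕ} (N : ℕ) (T : Amp d →ₗ[ℂ] Amp d) : FockN d N →ₗ.[ℂ] FockN d N where
  domain :=
    { carrier := {ψ | Memℓp (sectorMap N T ψ) 2}
      add_mem' := by
        intro ψ χ hψ hχ
        have h := Memℓp.add hψ hχ
        simpa only [Set.mem_ofPred_eq, lp.coeFn_add, map_add] using h
      zero_mem' := by
        have h : sectorMap N T ((0 : FockN d N) : Config d N → ℂ) = 0 := by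
          rw [lp.coeFn_zero, map_zero]
        simp only [Set.mem_ofPred_eq, h]
        exact zero_memℓp
      smul_mem' := by
        intro c ψ hψ
        have h := Memℓp.const_smul hψ c
        simpa only [Set.mem_ofPred_eq, lp.coeFn_smul, map_smul] using h }
  toFun :=
    { toFun := fun ψ => (⟨sectorMap N T ψ.1, ψ.2⟩ : FockN d N)
      map_add' := by
        intro ψ χ
        apply Subtype.ext
        change sectorMap N T ((ψ.1 + χ.1 : FockN d N) : Config d N → ℂ) = _
        rw [lp.coeFn_add, map_add]
        rfl
      map_smul' := by
        intro c ψ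
        apply Subtype.ext
        change sectorMap N T ((c • ψ.1 : FockN d N) : Config d N → ℂ) = _
        rw [lp.coeFn_smul, map_smul]
        rfl }

/-! ### Boundedness on the `N`-particle sector -/

/-- `T` is bounded, with square-norm constant `C`, on amplitudes supported on `M` particles. -/
def SectorBound {d : ℕ} (M : ℕ) (C : ℝ≥0∞) (T : Amp d →ₗ[ℂ] Amp d) : Prop :=
  ∀ ψ : Amp d, (∀ n, ψ n ≠ 0 → n.degree = M) →
    ∑' n, ‖T ψ n‖ₑ ^ 2 ≤ C * ∑' n, ‖ψ n‖ₑ ^ 2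

/-- `T` maps amplitudes supported on `M` particles to amplitudes supported on `M'` particles. -/
def SectorShift {d : ℕ} (M M' : ℕ) (T : Amp d →ₗ[ℂ] Amp d) : Prop :=
  ∀ ψ : Amp d, (∀ n, ψ n ≠ 0 → n.degree = M) → ∀ n, T ψ n ≠ 0 → n.degree = M'

theorem SectorBound.comp {d M M' : ℕ} {C C' : ℝ≥0∞} {S T : Amp d →ₗ[ℂ] Amp d}
    (hS : SectorBound M' C' S) (hT : SectorBound M C T) (hT' : SectorShift M M' T) :
    SectorBound M (C' * C) (S ∘ₗ T) := by
  intro ψ hψ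
  calc ∑' n, ‖(S ∘ₗ T) ψ n‖ₑ ^ 2 ≤ C' * ∑' n, ‖T ψ n‖ₑ ^ 2 := hS (T ψ) (hT' ψ hψ)
    _ ≤ C' * (C * ∑' n, ‖ψ n‖ₑ ^ 2) := by gcongr; exact hT ψ hψ
    _ = _ := by rw [mul_assoc]

theorem SectorShift.comp {d M M' M'' : ℕ} {S T : Amp d →ₗ[ℂ] Amp d}
    (hS : SectorShift M' M'' S) (hT : SectorShift M M' T) : SectorShift M M'' (S ∘ₗ T) :=
  fun ψ hψ => hS (T ψ) (hT ψ hψ)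

theorem ann_shift {d : ℕ} (M : ℕ) (j : Mode d) : SectorShift M (M - 1) (ann j) := by
  intro ψ hψ n hn
  have h : ψ (n + Finsupp.single j 1) ≠ 0 := right_ne_zero_of_mul hn
  have := hψ _ h
  simp at this
  omega

theorem tsub_single_add_single {d : ℕ} {n : Occ d} {j : Mode d} (h : n j ≠ 0) :
    (n - Finsupp.single j 1) + Finsupp.single j 1 = n :=
  tsub_add_cancel_of_le (by simpa using Nat.one_le_iff_ne_zero.mpr h)

theorem cre_shift {d : ℕ} (M : ℕ) (j : Mode d) : SectorShift M (M + 1) (cre j) := by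
  intro ψ hψ n hn
  have h1 : n j ≠ 0 := by
    intro h0
    apply hn
    simp [cre, h0]
  have h2 : ψ (n - Finsupp.single j 1) ≠ 0 := right_ne_zero_of_mul hn
  have h3 := hψ _ h2
  rw [← tsub_single_add_single h1]
  simp [h3]

theorem enorm_sqrt_sq (x : ℝ) (hx : 0 ≤ x) : ‖((Real.sqrt x : ℝ) : ℂ)‖ₑ ^ 2 = ENNReal.ofReal x := by
  rw [← ofReal_norm, ← ENNReal.ofReal_pow (norm_nonneg _)]
  simp [Real.sq_sqrt hx]

theorem ann_bound {d : ℕ} (M : ℕ) (j : Mode d) : SectorBound M (M : ℝ≥0∞) (ann j) := by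
  intro ψ hψ
  have hinj : Function.Injective (fun n : Occ d => n + Finsupp.single j 1) :=
    fun a b h => by simpa using h
  calc ∑' n, ‖ann j ψ n‖ₑ ^ 2
      ≤ ∑' n, (M : ℝ≥0∞) * ‖ψ (n + Finsupp.single j 1)‖ₑ ^ 2 := by
        refine ENNReal.tsum_le_tsum fun n => ?_
        by_cases h : ψ (n + Finsupp.single j 1) = 0
        · simp [ann, h]
        · have h1 := hψ _ h
          have h2 : (n + Finsupp.single j 1 : Occ d) j ≤ M := by
            rw [← h1]; exact Finsupp.le_degree j _
          change ‖(Real.sqrt ((n j : ℝ) + 1) : ℂ) * ψ (n + Finsupp.single j 1)‖ₑ ^ 2 ≤ _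
          rw [enorm_mul, mul_pow, enorm_sqrt_sq _ (by positivity)]
          gcongr
          rw [← ENNReal.ofReal_natCast]
          apply ENNReal.ofReal_le_ofReal
          have h3 : n j + 1 ≤ M := by simpa using h2
          exact_mod_cast h3
    _ = (M : ℝ≥0∞) * ∑' n, ‖ψ (n + Finsupp.single j 1)‖ₑ ^ 2 := ENNReal.tsum_mul_left
    _ ≤ _ := by
        exact mul_le_mul_right
          (ENNReal.tsum_comp_le_tsum_of_injective hinj (fun n => ‖ψ n‖ₑ ^ 2)) _

theorem cre_bound {d : ℕ} (M : ℕ) (j : Mode d) :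
    SectorBound M ((M + 1 : ℕ) : ℝ≥0∞) (cre j) := by
  intro ψ hψ
  have hinj : Function.Injective (fun n : Occ d => n + Finsupp.single j 1) :=
    fun a b h => by simpa using h
  have hsupp : Function.support (fun n => ‖cre j ψ n‖ₑ ^ 2) ⊆
      Set.range (fun n : Occ d => n + Finsupp.single j 1) := by
    intro n hn
    have h1 : n j ≠ 0 := by
      intro h0
      apply hn
      simp [cre, h0]
    exact ⟨_, tsub_single_add_single h1⟩
  rw [← hinj.tsum_eq hsupp, ← ENNReal.tsum_mul_left]
  refine ENNReal.tsum_le_tsum fun n => ?_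
  by_cases h : ψ n = 0
  · simp [cre, h]
  · have h1 := hψ _ h
    have h2 : n j ≤ M := by rw [← h1]; exact Finsupp.le_degree j _
    have h3 : cre j ψ (n + Finsupp.single j 1) = (Real.sqrt ((n j : ℝ) + 1) : ℂ) * ψ n := by
      simp [cre]
    rw [h3, enorm_mul, mul_pow, enorm_sqrt_sq _ (by positivity)]
    gcongr
    rw [← ENNReal.ofReal_natCast]
    apply ENNReal.ofReal_le_ofReal
    exact_mod_cast Nat.succ_le_succ h2

theorem SectorBound.smul {d M : ℕ} {C : ℝ≥0∞} {T : Amp d →ₗ[ℂ] Amp d} (c : ℂ)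
    (hT : SectorBound M C T) : SectorBound M (‖c‖ₑ ^ 2 * C) (c • T) := by
  intro ψ hψ
  calc ∑' n, ‖(c • T) ψ n‖ₑ ^ 2 = ‖c‖ₑ ^ 2 * ∑' n, ‖T ψ n‖ₑ ^ 2 := by
        rw [← ENNReal.tsum_mul_left]
        refine tsum_congr fun n => ?_
        simp [enorm_mul, mul_pow]
    _ ≤ ‖c‖ₑ ^ 2 * (C * ∑' n, ‖ψ n‖ₑ ^ 2) := by gcongr; exact hT ψ hψ
    _ = _ := by rw [mul_assoc]

theorem SectorBound.exists_nnreal {d M : ℕ} {C : ℝ≥0∞} {T : Amp d →ₗ[ℂ] Amp d}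
    (hT : SectorBound M C T) (hC : C ≠ ∞) : ∃ C' : ℝ≥0, SectorBound M C' T :=
  ⟨C.toNNReal, by rwa [ENNReal.coe_toNNReal hC]⟩

theorem tsum_extend {d N : ℕ} (ψ : Config d N → ℂ) :
    ∑' n, ‖extend d N ψ n‖ₑ ^ 2 = ∑' n, ‖ψ n‖ₑ ^ 2 := by
  have hsupp : Function.support (fun n => ‖extend d N ψ n‖ₑ ^ 2) ⊆
      Set.range (Subtype.val : Config d N → Occ d) := by
    intro n hn
    by_cases h : n.degree = N
    · exact ⟨⟨n, h⟩, rfl⟩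
    · exact absurd (by simp [extend, h]) hn
  rw [← Subtype.val_injective.tsum_eq hsupp]
  refine tsum_congr fun n => ?_
  simp [extend, n.2]

theorem enorm_tsum_lp {d N : ℕ} (ψ : FockN d N) : ∑' n, ‖ψ n‖ₑ ^ 2 = ENNReal.ofReal (‖ψ‖ ^ 2) := by
  have h := lp.norm_rpow_eq_tsum (p := 2) (by simp) ψ
  have hs := (lp.memℓp ψ).summable (by simp)
  simp only [ENNReal.toReal_ofNat, Real.rpow_ofNat] at h hs
  rw [h, ENNReal.ofReal_tsum_of_nonneg (fun n => by positivity) hs]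
  refine tsum_congr fun n => ?_
  rw [← ofReal_norm, ENNReal.ofReal_pow (norm_nonneg _)]

theorem sector_tsum_le {d N : ℕ} {C : ℝ≥0} {T : Amp d →ₗ[ℂ] Amp d} (hT : SectorBound N C T)
    (ψ : FockN d N) :
    ∑' n, ‖sectorMap N T ψ n‖ₑ ^ 2 ≤ ENNReal.ofReal (C * ‖ψ‖ ^ 2) := by
  calc ∑' n, ‖sectorMap N T ψ n‖ₑ ^ 2
      ≤ ∑' n, ‖T (extend d N ψ) n‖ₑ ^ 2 :=
        ENNReal.tsum_comp_le_tsum_of_injective Subtype.val_injective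
          (fun n => ‖T (extend d N ψ) n‖ₑ ^ 2)
    _ ≤ C * ∑' n, ‖extend d N ψ n‖ₑ ^ 2 := by
        refine hT _ fun n hn => ?_
        by_contra h
        exact hn (by simp [extend, h])
    _ = _ := by
        rw [tsum_extend, enorm_tsum_lp, ENNReal.ofReal_mul (by positivity), ENNReal.ofReal_coe_nnreal]

theorem sector_memℓp {d N : ℕ} {C : ℝ≥0} {T : Amp d →ₗ[ℂ] Amp d} (hT : SectorBound N C T)
    (ψ : FockN d N) : Memℓp (sectorMap N T ψ) 2 := by
  apply memℓp_gen
  have h := ne_top_of_le_ne_top ENNReal.ofReal_ne_top (sector_tsum_le hT ψ)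
  simp only [ENNReal.toReal_ofNat, Real.rpow_ofNat]
  have h2 := ENNReal.summable_toReal h
  simpa using h2

/-- The bounded operator on `𝓕^N` given by an operator on amplitudes. -/
def sectorCLM {d : ℕ} (N : ℕ) (T : Amp d →ₗ[ℂ] Amp d) (hT : ∃ C : ℝ≥0, SectorBound N C T) :
    FockN d N →L[ℂ] FockN d N :=
  LinearMap.mkContinuousOfExistsBound
    { toFun := fun ψ => (⟨sectorMap N T ψ, sector_memℓp hT.choose_spec ψ⟩ : FockN d N)
      map_add' := by
        intro ψ χ
        apply Subtype.ext
        change sectorMap N T ((ψ + χ : FockN d N) : Config d N → ℂ) = _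
        rw [lp.coeFn_add, map_add]
        rfl
      map_smul' := by
        intro c ψ
        apply Subtype.ext
        change sectorMap N T ((c • ψ : FockN d N) : Config d N → ℂ) = _
        rw [lp.coeFn_smul, map_smul]
        rfl }
    (by
      obtain ⟨C, hC⟩ := hT
      refine ⟨Real.sqrt C, fun ψ => ?_⟩
      have h := sector_tsum_le hC ψ
      set χ : FockN d N := ⟨sectorMap N T ψ, sector_memℓp hC ψ⟩ with hχ
      change ‖χ‖ ≤ _
      have h2 : ENNReal.ofReal (‖χ‖ ^ 2) ≤ ENNReal.ofReal (C * ‖ψ‖ ^ 2) := by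
        rw [← enorm_tsum_lp]; exact h
      have h3 : ‖χ‖ ^ 2 ≤ C * ‖ψ‖ ^ 2 := (ENNReal.ofReal_le_ofReal_iff (by positivity)).1 h2
      apply le_of_sq_le_sq _ (by positivity)
      rw [mul_pow, Real.sq_sqrt (NNReal.coe_nonneg C)]
      exact h3)

/-! ## Operators with domains and the Feshbach–Schur map -/

section Feshbach

variable {E : Type*} [NormedAddCommGroup E] [NormedSpace ℂ E]

/-- A bounded operator as an everywhere defined operator. -/
def toP (A : E →L[ℂ] E) : E →ₗ.[ℂ] E := (A : E →ₗ[ℂ] E).toPMap ⊤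

/-- The product `A B`, on its natural domain `{ψ ∈ D(B) | B ψ ∈ D(A)}`. -/
def prodP (A B : E →ₗ.[ℂ] E) : E →ₗ.[ℂ] E where
  domain := (A.domain.comap B.toFun).map B.domain.subtype
  toFun :=
    { toFun := fun ψ => A ⟨B ⟨ψ.1, by
          obtain ⟨_, ⟨y, _, rfl⟩⟩ := ψ; exact y.2⟩, by
          obtain ⟨_, ⟨y, hy, rfl⟩⟩ := ψ; exact hy⟩
      map_add' := by
        intro ψ χ
        rw [← A.map_add]
        congr 1
        apply Subtype.ext
        simp only [Submodule.coe_add]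
        rw [← B.map_add]
        rfl
      map_smul' := by
        intro c ψ
        simp only [RingHom.id_apply]
        rw [← A.map_smul]
        congr 1
        apply Subtype.ext
        simp only [Submodule.coe_smul]
        rw [← B.map_smul]
        rfl }

/-- The sandwiched operator `P K P`. -/
def sandwich (P : E →L[ℂ] E) (K : E →ₗ.[ℂ] E) : E →ₗ.[ℂ] E :=
  prodP (toP P) (prodP K (toP P))

/-- For a projection `Q`, the bounded operator `R = Q (Q K Q)⁻¹ Q`: it lives on `Q E`, and there it
is the two-sided inverse of `Q K Q : Q E ∩ D(K) → Q E`. -/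
structure IsBlockInverse (Q : E →L[ℂ] E) (K : E →ₗ.[ℂ] E) (R : E →L[ℂ] E) : Prop where
  block : Q * R * Q = R
  right_inv : ∀ ψ : E, ∃ h : R ψ ∈ K.domain, Q (K ⟨R ψ, h⟩) = Q ψ
  left_inv : ∀ ψ : K.domain, Q ψ = ψ → R (K ψ) = ψ

/-- `Q K Q` is bounded invertible on `Q E`. -/
def BlockInvertible (Q : E →L[ℂ] E) (K : E →ₗ.[ℂ] E) : Prop :=
  ∃ R : E →L[ℂ] E, IsBlockInverse Q K R

theorem IsBlockInverse.unique {Q : E →L[ℂ] E} {K : E →ₗ.[ℂ] E} {R R' : E →L[ℂ] E}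
    (hQ : Q * Q = Q) (h : IsBlockInverse Q K R) (h' : IsBlockInverse Q K R') : R = R' := by
  ext ψ
  obtain ⟨hd, he⟩ := h.right_inv ψ
  have hq : ∀ {S : E →L[ℂ] E}, IsBlockInverse Q K S → ∀ χ, S (Q χ) = S χ := by
    intro S hS χ
    have h1 : S * Q = S := by
      rw [← hS.block]
      simp only [mul_assoc, hQ]
    exact congrArg (fun T : E →L[ℂ] E => T χ) h1
  have hQR : Q (R ψ) = R ψ := by
    have h1 : Q * R = R := by
      rw [← h.block]
      simp only [← mul_assoc, hQ]
    exact congrArg (fun T : E →L[ℂ] E => T ψ) h1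
  have h2 := h'.left_inv ⟨R ψ, hd⟩ hQR
  rw [← hq h', he, hq h'] at h2
  exact h2.symm

open Classical in
/-- `Q (Q K Q)⁻¹ Q` (and `0` if `Q K Q` is not bounded invertible on `Q E`). -/
def blockInv (Q : E →L[ℂ] E) (K : E →ₗ.[ℂ] E) : E →L[ℂ] E :=
  if h : BlockInvertible Q K then h.choose else 0

/-- The Feshbach–Schur map for the projections `P`, `Q`:
`P K P - P K Q (Q K Q)⁻¹ Q K P`. An operator on `P E` is extended by `0` to the rest of `E`. -/
def feshbach (P Q : E →L[ℂ] E) (K : E →ₗ.[ℂ] E) : E →ₗ.[ℂ] E :=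
  sandwich P K -
    prodP (toP P) (prodP K (prodP (toP Q) (prodP (toP (blockInv Q K))
      (prodP (toP Q) (prodP K (toP P))))))

end Feshbach

/-- The nonnegative square root of a nonnegative bounded operator on a Hilbert space. -/
def opSqrt {E : Type*} [NormedAddCommGroup E] [InnerProductSpace ℂ E] [CompleteSpace E]
    (A : E →L[ℂ] E) : E →L[ℂ] E := CFC.sqrt A

/-! ## The three-modes Bogoliubov Hamiltonian -/

/-- The data of the three-modes system: `N` (even) particles in a `d`-dimensional box of side `L`
with periodic boundary conditions, and a pair potential whose Fourier component at the nonzero modes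
`±j` is `phi > 0`. -/
structure ThreeModes (d : ℕ) where
  L : ℝ
  L_pos : 0 < L
  N : ℕ
  N_even : Even N
  j : Mode d
  j_ne_zero : j ≠ 0
  phi : ℝ
  phi_pos : 0 < phi

namespace ThreeModes

variable {d : ℕ} (S : ThreeModes d)

/-- `k_l² = |(2π/L) l|²`. -/
def ksq (l : Mode d) : ℝ := ∑ r, (2 * Real.pi / S.L * (l r : ℝ)) ^ 2

/-- The ratio `ε = k_{j}² / φ_{j}`. -/
def eps : ℝ := S.ksq S.j / S.phi

/-- The Bogoliubov energy `E^{Bog}_{j}`. -/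
def EBog : ℝ :=
  -(S.ksq S.j + S.phi - Real.sqrt ((S.ksq S.j) ^ 2 + 2 * S.phi * S.ksq S.j))

/-- `W = φ a_0^* a_0^* a_j a_{-j} / N` on amplitudes. -/
def WAmp : Amp d →ₗ[ℂ] Amp d :=
  ((S.phi / S.N : ℝ) : ℂ) • (cre 0 ∘ₗ cre 0 ∘ₗ ann S.j ∘ₗ ann (-S.j))

/-- `W^* = φ a_0 a_0 a_j^* a_{-j}^* / N` on amplitudes. -/
def WstarAmp : Amp d →ₗ[ℂ] Amp d :=
  ((S.phi / S.N : ℝ) : ℂ) • (ann 0 ∘ₗ ann 0 ∘ₗ cre S.j ∘ₗ cre (-S.j))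

/-- `(k_j² + φ a_0^* a_0 / N) (a_j^* a_j + a_{-j}^* a_{-j})` on amplitudes. -/
def H0Amp : Amp d →ₗ[ℂ] Amp d :=
  (((S.ksq S.j : ℝ) : ℂ) • LinearMap.id + ((S.phi / S.N : ℝ) : ℂ) • (cre 0 ∘ₗ ann 0)) ∘ₗ
    (cre S.j ∘ₗ ann S.j + cre (-S.j) ∘ₗ ann (-S.j))

/-- The kinetic energy `∑_{l ≠ ±j} k_l² a_l^* a_l` of the other modes on amplitudes; at the
occupation numbers `n` only the modes `l` with `n_l ≠ 0` contribute. -/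
def kinAmp : Amp d →ₗ[ℂ] Amp d where
  toFun ψ := fun n =>
    ∑ l ∈ n.support with l ≠ S.j ∧ l ≠ -S.j, ((S.ksq l : ℝ) : ℂ) * cre l (ann l ψ) n
  map_add' ψ χ := by funext n; simp [mul_add, Finset.sum_add_distrib]
  map_smul' c ψ := by
    funext n
    simp only [map_smul, Pi.smul_apply, smul_eq_mul, RingHom.id_apply, Finset.mul_sum]
    exact Finset.sum_congr rfl fun l _ => by ring

/-- The Hamiltonian `H^{Bog}_{j}` on `𝓕^N`. -/
def HBog : FockN d S.N →ₗ.[ℂ] FockN d S.N :=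
  sectorOp S.N (S.kinAmp + (S.H0Amp + S.WAmp + S.WstarAmp))

theorem WAmp_bound : ∃ C : ℝ≥0, SectorBound S.N C S.WAmp := by
  have h := ((cre_bound _ 0).comp ((cre_bound _ 0).comp ((ann_bound _ S.j).comp
    (ann_bound S.N (-S.j)) (ann_shift _ _)) ((ann_shift _ _).comp (ann_shift _ _)))
    ((cre_shift _ _).comp ((ann_shift _ _).comp (ann_shift _ _)))).smul
    (((S.phi / S.N : ℝ) : ℂ))
  exact h.exists_nnreal (by finiteness)

theorem WstarAmp_bound : ∃ C : ℝ≥0, SectorBound S.N C S.WstarAmp := by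
  have h := ((ann_bound _ 0).comp ((ann_bound _ 0).comp ((cre_bound _ S.j).comp
    (cre_bound S.N (-S.j)) (cre_shift _ _)) ((cre_shift _ _).comp (cre_shift _ _)))
    ((ann_shift _ _).comp ((cre_shift _ _).comp (cre_shift _ _)))).smul
    (((S.phi / S.N : ℝ) : ℂ))
  exact h.exists_nnreal (by finiteness)

/-- The bounded operator `W` on `𝓕^N`. -/
def W : FockN d S.N →L[ℂ] FockN d S.N := sectorCLM S.N S.WAmp S.WAmp_bound

/-- The bounded operator `W^*` on `𝓕^N`. -/
def Wstar : FockN d S.N →L[ℂ] FockN d S.N := sectorCLM S.N S.WstarAmp S.WstarAmp_bound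

/-! ## Feshbach–Schur flow -/

open Classical in
/-- Orthogonal projection onto the closed span of the product states `φ_n`, `n ∈ A`. -/
def proj (A : Set (Occ d)) : FockN d S.N →L[ℂ] FockN d S.N :=
  sectorCLM S.N
    { toFun := fun ψ n => if n ∈ A then ψ n else 0
      map_add' := by intro ψ χ; funext n; by_cases h : n ∈ A <;> simp [h]
      map_smul' := by intro c ψ; funext n; by_cases h : n ∈ A <;> simp [h] }
    ⟨1, by
      intro ψ _
      simp only [ENNReal.coe_one, one_mul]
      refine ENNReal.tsum_le_tsum fun n => ?_
      by_cases h : n ∈ A <;> simp [h]⟩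

/-- `Q^{(i,i+1)}`: the number of particles in the modes `±j` is `N - i` or `N - i - 1`. -/
def Q (i : ℕ) : FockN d S.N →L[ℂ] FockN d S.N :=
  S.proj {n | n S.j + n (-S.j) + i = S.N ∨ n S.j + n (-S.j) + (i + 1) = S.N}

/-- `Q^{(>i+1)}`: the number of particles in the modes `±j` is less than `N - i - 1`. -/
def QGt (i : ℕ) : FockN d S.N →L[ℂ] FockN d S.N :=
  S.proj {n | n S.j + n (-S.j) + (i + 1) < S.N}

/-- `H^{Bog}_{j} - z`. -/
def HSub (z : ℝ) : FockN d S.N →ₗ.[ℂ] FockN d S.N := S.HBog - toP ((z : ℂ) • 1)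

/-- The operator to which the Feshbach–Schur map of step `i = 2 s` is applied (`K^{(i-2)}(z)`, where
`K^{(-2)}(z) = H^{Bog}_{j} - z`). -/
def KPrev (z : ℝ) : ℕ → (FockN d S.N →ₗ.[ℂ] FockN d S.N)
  | 0 => S.HSub z
  | s + 1 => feshbach (S.QGt (2 * s)) (S.Q (2 * s)) (KPrev z s)

/-- The Feshbach–Schur Hamiltonian `K^{Bog,(i)}_{j}(z)`, `i = 2 s`. -/
def K (z : ℝ) (s : ℕ) : FockN d S.N →ₗ.[ℂ] FockN d S.N :=
  feshbach (S.QGt (2 * s)) (S.Q (2 * s)) (S.KPrev z s)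

/-- `R_{i,i}(z) = Q^{(i,i+1)} (Q^{(i,i+1)} (H - z) Q^{(i,i+1)})⁻¹ Q^{(i,i+1)}`. -/
def R (z : ℝ) (i : ℕ) : FockN d S.N →L[ℂ] FockN d S.N := blockInv (S.Q i) (S.HSub z)

/-- `R_{i,i}(z)^{1/2}`. -/
def Rsqrt (z : ℝ) (i : ℕ) : FockN d S.N →L[ℂ] FockN d S.N := opSqrt (S.R z i)

/-- `W_{i,i'} = Q^{(i,i+1)} W Q^{(i',i'+1)}`. -/
def Wblock (i i' : ℕ) : FockN d S.N →L[ℂ] FockN d S.N := S.Q i * S.W * S.Q i'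

/-- `W^*_{i,i'} = Q^{(i,i+1)} W^* Q^{(i',i'+1)}`. -/
def Wstarblock (i i' : ℕ) : FockN d S.N →L[ℂ] FockN d S.N := S.Q i * S.Wstar * S.Q i'

/-- The effective interaction `Γ_{i,i}(z)`, `i = 2 s`, for `i ≥ 2` (set to `0` for `i = 0`, where it
is not used). -/
def Gam (z : ℝ) : ℕ → (FockN d S.N →L[ℂ] FockN d S.N)
  | 0 => 0
  | 1 => S.Wblock 2 0 * S.R z 0 * S.Wstarblock 0 2
  | s + 2 =>
      S.Wblock (2 * (s + 2)) (2 * (s + 1)) * S.R z (2 * (s + 1)) *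
        (∑' l : ℕ, (Gam z (s + 1) * S.R z (2 * (s + 1))) ^ l) *
        S.Wstarblock (2 * (s + 1)) (2 * (s + 2))

/-- `R_{i,i}^{1/2} Γ_{i,i} R_{i,i}^{1/2}`, `i = 2 s`. -/
def GamSym (z : ℝ) (s : ℕ) : FockN d S.N →L[ℂ] FockN d S.N :=
  S.Rsqrt z (2 * s) * S.Gam z s * S.Rsqrt z (2 * s)

/-- `Γ̌_{i,i}(z)`, `i = 2 s`: the sum `∑_l (R^{1/2} Γ R^{1/2})^l` for `i ≥ 2`, and `1` for `i = 0`. -/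
def GamCheck (z : ℝ) : ℕ → (FockN d S.N →L[ℂ] FockN d S.N)
  | 0 => 1
  | s + 1 => ∑' l : ℕ, (S.GamSym z (s + 1)) ^ l

end ThreeModes

/-! ## The auxiliary sequence -/

/-- Characteristic function of `[0,2)`. -/
def chi (δ : ℝ) : ℝ := Set.indicator (Set.Ico (0 : ℝ) 2) 1 δ

/-- `b_ε`, with `δ = 1 + √ε`. -/
def bSeq (ε : ℝ) : ℝ :=
  (1 + ε) * (1 + Real.sqrt ε) * chi (1 + Real.sqrt ε) * Real.sqrt (ε ^ 2 + 2 * ε)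

/-- `c_ε`, with `δ = 1 + √ε`. -/
def cSeq (ε : ℝ) : ℝ :=
  -(1 - (1 + Real.sqrt ε) ^ 2 * chi (1 + Real.sqrt ε)) * (ε ^ 2 + 2 * ε)

/-- `XSeq a ε N s` is `X_{2 s}` for the parameters `a_ε = a`, `b_ε`, `c_ε`. -/
def XSeq (a ε : ℝ) (N : ℕ) : ℕ → ℝ
  | 0 => 1
  | s + 1 =>
      1 - 1 / (4 * (1 + a - 2 * bSeq ε / ((N : ℝ) - 2 * s - 1)
        - (1 - cSeq ε) / ((N : ℝ) - 2 * s - 1) ^ 2) * XSeq a ε N s)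

end Bogoliubov

end

/-! In the occupation number basis everything except `W` and `W*` is multiplication by a real
function, and `W`, `W*` are weighted shifts: they move one pair between the zero mode and the modes
±j, along the partially inverse maps `up` and `down`. Hence `W D W*` is diagonal whenever `D` is. A
shift changes the number of particles in ±j by two, while `Q^{(i,i+1)}` admits two consecutive
values, so `H - z` is diagonal on that block and `R` is multiplication by `1 / (energy - z)`. By
induction every `Γ` is diagonal (`isDiag_Gam`), and the correction produced by one Feshbach–Schur
step is exactly the next `Γ` (`isDiag_effective`). Domains cause no trouble because the flow stays
in the class "real multiplication on its maximal domain plus a bounded operator" (`feshbach_mulP`),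
in which self-adjointness only concerns the bounded part (`isSelfAdjoint_mulP`). `flow` collects
this.

The rest is a scalar continued fraction. Put `t s = gam s * rho s`. Then `t (s+1)` at `n` is `c / (1
- t s)`, with `t s` taken at `up n` and `c = coefW² ρ ρ`. If `c ≤ (1 - X (s+1)) * X s`, then `t s ≤
1 - X s` by induction (`gam_mem`), so the Neumann series converge and are bounded by `1 / X s`. The
recursion for `X` says that `(1 - X (s+1)) * X s = 1 / (4 * denom)`, so two estimates remain.

First, `c ≤ 1 / (4 * denom)` (`coefW_sq_mul_rho_le`): the kinetic energy of the other modes is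
dropped, the occupations of j and -j are symmetrised, `sector_product_le` cancels the zero mode, and
`denom_le` recognises `b_ε` and `c_ε`.

Second, `X` is bounded below (`le_XSeq`). At ε = 0 the recursion, apart from its initial value, is
solved exactly by `(1 - 1/(N-2s))/2`, whose last value, at `N - 2s = 2`, is 1/4. For small ε the
perturbation `(1 + σ - τ/(N-2s-q))/2` with `τ = 1 + 2√ε`, `σ = b_ε/τ`, `q = ε^{1/4}` is a
subsolution (`subsolution_step`). -/

noncomputable section

namespace Bogoliubov

/-! ### Diagonal bounded operators on ℓ². -/

section Diagonal

variable {ι : Type*}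

/-- The Hilbert space `ℓ²(ι)`. -/
abbrev Ltwo (ι : Type*) := lp (fun _ : ι => ℂ) 2

/-- `A` acts as multiplication by `f`. -/
def IsDiag (A : Ltwo ι →L[ℂ] Ltwo ι) (f : ι → ℝ) : Prop :=
  ∀ (ψ : Ltwo ι) (n : ι), A ψ n = (f n : ℂ) * ψ n

theorem IsDiag.eq {A B : Ltwo ι →L[ℂ] Ltwo ι} {f : ι → ℝ} (hA : IsDiag A f) (hB : IsDiag B f) :
    A = B := by
  ext ψ n
  rw [hA, hB]

theorem IsDiag.congr {A : Ltwo ι →L[ℂ] Ltwo ι} {f g : ι → ℝ} (hA : IsDiag A f)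
    (h : ∀ n, f n = g n) : IsDiag A g := by
  rwa [← funext h]

theorem isDiag_one : IsDiag (1 : Ltwo ι →L[ℂ] Ltwo ι) (fun _ => 1) := by
  intro ψ n; simp

theorem isDiag_zero : IsDiag (0 : Ltwo ι →L[ℂ] Ltwo ι) (fun _ => 0) := by
  intro ψ n; simp

theorem IsDiag.mul {A B : Ltwo ι →L[ℂ] Ltwo ι} {f g : ι → ℝ} (hA : IsDiag A f)
    (hB : IsDiag B g) : IsDiag (A * B) (fun n => f n * g n) := by
  intro ψ n
  rw [mul_apply_eq_comp, hA, hB]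
  push_cast; ring

theorem IsDiag.sub {A B : Ltwo ι →L[ℂ] Ltwo ι} {f g : ι → ℝ} (hA : IsDiag A f)
    (hB : IsDiag B g) : IsDiag (A - B) (fun n => f n - g n) := by
  intro ψ n
  rw [sub_apply, lp.coeFn_sub, Pi.sub_apply, hA, hB]
  push_cast; ring

theorem memℓp_two_of_le {φ : ι → ℂ} {ψ : ι → ℂ} {C : ℝ} (hψ : Memℓp ψ 2)
    (h : ∀ n, ‖φ n‖ ≤ C * ‖ψ n‖) : Memℓp φ 2 :=
  (hψ.norm.const_smul C).mono h

theorem norm_le_of_forall_norm_le {φ ψ : Ltwo ι} {C : ℝ} (hC : 0 ≤ C)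
    (h : ∀ n, ‖φ n‖ ≤ C * ‖ψ n‖) : ‖φ‖ ≤ C * ‖ψ‖ := by
  refine lp.norm_le_of_forall_sum_le (by simp) (by positivity) fun s => ?_
  rw [Real.mul_rpow hC (norm_nonneg _), lp.norm_rpow_eq_tsum (by simp) ψ]
  have hs := (lp.memℓp ψ).summable (by simp)
  calc ∑ i ∈ s, ‖φ i‖ ^ (2 : ℝ≥0∞).toReal
      ≤ ∑ i ∈ s, C ^ (2 : ℝ≥0∞).toReal * ‖ψ i‖ ^ (2 : ℝ≥0∞).toReal := by
        refine Finset.sum_le_sum fun i _ => ?_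
        rw [← Real.mul_rpow hC (norm_nonneg _)]
        exact Real.rpow_le_rpow (norm_nonneg _) (h i) (by simp)
    _ = C ^ (2 : ℝ≥0∞).toReal * ∑ i ∈ s, ‖ψ i‖ ^ (2 : ℝ≥0∞).toReal := by rw [Finset.mul_sum]
    _ ≤ _ := by
        gcongr
        exact hs.sum_le_tsum s fun i _ => by positivity

theorem IsDiag.norm_le {A : Ltwo ι →L[ℂ] Ltwo ι} {f : ι → ℝ} (hA : IsDiag A f) {C : ℝ}
    (hC : 0 ≤ C) (h : ∀ n, |f n| ≤ C) : ‖A‖ ≤ C := by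
  refine A.opNorm_le_bound hC fun ψ => norm_le_of_forall_norm_le hC fun n => ?_
  rw [hA, norm_mul, Complex.norm_real, Real.norm_eq_abs]
  exact mul_le_mul_of_nonneg_right (h n) (norm_nonneg _)

theorem exists_isDiag (f : ι → ℝ) {C : ℝ} (h : ∀ n, |f n| ≤ C) :
    ∃ A : Ltwo ι →L[ℂ] Ltwo ι, IsDiag A f := by
  have hb : ∀ (ψ : Ltwo ι) n, ‖(f n : ℂ) * ψ n‖ ≤ max C 0 * ‖ψ n‖ := by
    intro ψ n
    rw [norm_mul, Complex.norm_real, Real.norm_eq_abs]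
    exact mul_le_mul_of_nonneg_right ((h n).trans (le_max_left _ _)) (norm_nonneg _)
  let L : Ltwo ι →ₗ[ℂ] Ltwo ι :=
    { toFun := fun ψ => ⟨fun n => (f n : ℂ) * ψ n, memℓp_two_of_le (lp.memℓp ψ) (hb ψ)⟩
      map_add' := by
        intro ψ χ
        apply Subtype.ext
        funext n
        exact mul_add _ _ _
      map_smul' := by
        intro c ψ
        apply Subtype.ext
        funext n
        simp only [lp.coeFn_smul, Pi.smul_apply, smul_eq_mul, RingHom.id_apply]
        ring }
  exact ⟨L.mkContinuous (max C 0) fun ψ =>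
    norm_le_of_forall_norm_le (le_max_right _ _) (hb ψ), fun ψ n => rfl⟩

theorem IsDiag.nonneg {A : Ltwo ι →L[ℂ] Ltwo ι} {f : ι → ℝ} (hA : IsDiag A f)
    (h : ∀ n, 0 ≤ f n) : 0 ≤ A := by
  rw [ContinuousLinearMap.nonneg_iff_isPositive]
  refine ⟨fun ψ χ => ?_, fun ψ => ?_⟩
  · rw [lp.inner_eq_tsum, lp.inner_eq_tsum]
    refine tsum_congr fun n => ?_
    simp only [ContinuousLinearMap.coe_coe]
    rw [hA, hA]
    simp
    ring
  · rw [ContinuousLinearMap.reApplyInnerSelf_apply, lp.inner_eq_tsum,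
      RCLike.re_tsum _ (lp.summable_inner _ _)]
    refine tsum_nonneg fun n => ?_
    rw [hA, RCLike.inner_apply]
    have : (ψ n) * (starRingEnd ℂ) ((f n : ℂ) * ψ n) = ((f n * ‖ψ n‖ ^ 2 : ℝ) : ℂ) := by
      rw [map_mul, Complex.conj_ofReal]
      push_cast
      rw [← Complex.mul_conj']
      ring
    rw [this]
    simp only [RCLike.re_to_complex, Complex.ofReal_re]
    have := h n
    positivity

/-- Uniqueness of the nonnegative square root identifies it with multiplication by `√f`, which is
bounded because `f` is. -/
theorem IsDiag.opSqrt {A : Ltwo ι →L[ℂ] Ltwo ι} {f : ι → ℝ} (hA : IsDiag A f)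
    (h : ∀ n, 0 ≤ f n) {C : ℝ} (hC : ∀ n, f n ≤ C) :
    IsDiag (opSqrt A) (fun n => Real.sqrt (f n)) := by
  obtain ⟨B, hB⟩ := exists_isDiag (fun n => Real.sqrt (f n)) (C := Real.sqrt C) fun n => by
    rw [abs_of_nonneg (Real.sqrt_nonneg _)]
    exact Real.sqrt_le_sqrt (hC n)
  have : Bogoliubov.opSqrt A = B := by
    refine CFC.sqrt_unique ?_ (hB.nonneg fun n => Real.sqrt_nonneg _)
    exact ((hB.mul hB).congr fun n => Real.mul_self_sqrt (h n)).eq hA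
  rwa [this]

theorem IsDiag.summable_pow {A : Ltwo ι →L[ℂ] Ltwo ι} {f : ι → ℝ} (hA : IsDiag A f) {C : ℝ}
    (hC : 0 ≤ C) (hC1 : C < 1) (h : ∀ n, |f n| ≤ C) : Summable fun l : ℕ => A ^ l :=
  summable_geometric_of_norm_lt_one ((hA.norm_le hC h).trans_lt hC1)

/-- The identity `(1 - A) ∑ A ^ l = 1`, read at one coordinate, determines the sum there. -/
theorem IsDiag.tsum_pow {A : Ltwo ι →L[ℂ] Ltwo ι} {f : ι → ℝ} (hA : IsDiag A f) {C : ℝ}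
    (hC : 0 ≤ C) (hC1 : C < 1) (h : ∀ n, |f n| ≤ C) :
    IsDiag (∑' l : ℕ, A ^ l) (fun n => (1 - f n)⁻¹) := by
  intro ψ n
  have h1 := mul_neg_geom_series A ((hA.norm_le hC h).trans_lt hC1)
  have h2 := (isDiag_one.sub hA) ((∑' l : ℕ, A ^ l) ψ) n
  rw [← mul_apply_eq_comp, h1, one_apply_eq_self] at h2
  have h3 : (1 - f n) ≠ 0 := by
    have := (abs_le.1 (h n)).2
    linarith
  have h3' : ((1 - f n : ℝ) : ℂ) ≠ 0 := Complex.ofReal_ne_zero.2 h3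
  rw [h2, Complex.ofReal_inv, inv_mul_cancel_left₀ h3']

end Diagonal

/-! ### Unbounded multiplication operators with bounded perturbations, and their Feshbach–Schur
maps. -/

section Multiplication

variable {ι : Type*}

/-- Multiplication by the real function `f` on its maximal domain, plus the bounded operator `B`. -/
def mulP (f : ι → ℝ) (B : Ltwo ι →L[ℂ] Ltwo ι) : Ltwo ι →ₗ.[ℂ] Ltwo ι where
  domain :=
    { carrier := {ψ | Memℓp (fun n => (f n : ℂ) * ψ n) 2}
      add_mem' := by
        intro ψ χ hψ hχ
        have h := Memℓp.add hψ hχ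
        simp only [Set.mem_ofPred_eq] at h ⊢
        convert h using 1
        funext n
        simp [mul_add]
      zero_mem' := by
        simp only [Set.mem_ofPred_eq, lp.coeFn_zero, Pi.zero_apply, mul_zero]
        exact zero_memℓp
      smul_mem' := by
        intro c ψ hψ
        have h := Memℓp.const_smul hψ c
        simp only [Set.mem_ofPred_eq] at h ⊢
        convert h using 1
        funext n
        simp
        ring }
  toFun :=
    { toFun := fun ψ => (⟨fun n => (f n : ℂ) * ψ.1 n, ψ.2⟩ : Ltwo ι) + B ψ.1
      map_add' := by
        intro ψ χ
        apply Subtype.ext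
        funext n
        change (f n : ℂ) * (ψ.1 n + χ.1 n) + B (ψ.1 + χ.1) n =
          ((f n : ℂ) * ψ.1 n + B ψ.1 n) + ((f n : ℂ) * χ.1 n + B χ.1 n)
        rw [map_add, lp.coeFn_add, Pi.add_apply]
        ring
      map_smul' := by
        intro c ψ
        apply Subtype.ext
        funext n
        change (f n : ℂ) * (c * ψ.1 n) + B (c • ψ.1) n = c * ((f n : ℂ) * ψ.1 n + B ψ.1 n)
        rw [map_smul, lp.coeFn_smul, Pi.smul_apply, smul_eq_mul]
        ring }

theorem mulP_apply (f : ι → ℝ) (B : Ltwo ι →L[ℂ] Ltwo ι) (ψ : (mulP f B).domain) (n : ι) :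
    mulP f B ψ n = (f n : ℂ) * ψ.1 n + B ψ.1 n := rfl

theorem mem_graph_iff_exists {E : Type*} [AddCommGroup E] [Module ℂ E] (A : E →ₗ.[ℂ] E)
    (ψ χ : E) : (ψ, χ) ∈ A.graph ↔ ∃ h : ψ ∈ A.domain, A ⟨ψ, h⟩ = χ := by
  rw [LinearPMap.mem_graph_iff]
  constructor
  · rintro ⟨⟨y, hy⟩, rfl, h⟩
    exact ⟨hy, h⟩
  · rintro ⟨h, h'⟩
    exact ⟨⟨ψ, h⟩, rfl, h'⟩

/-- Graphs carry domain and values together, so the operator identities below need no separate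
comparison of domains. -/
theorem pmap_ext_of_graph {E : Type*} [AddCommGroup E] [Module ℂ E] {A B : E →ₗ.[ℂ] E}
    (h : ∀ ψ χ, (ψ, χ) ∈ A.graph ↔ (ψ, χ) ∈ B.graph) : A = B :=
  LinearPMap.eq_of_eq_graph (Submodule.ext fun ⟨ψ, χ⟩ => h ψ χ)

/-- No domain condition survives: `χ - B ψ` lies in ℓ², so the pointwise formula already makes `f ψ`
square summable. -/
theorem mem_graph_mulP {f : ι → ℝ} {B : Ltwo ι →L[ℂ] Ltwo ι} {ψ χ : Ltwo ι} :
    (ψ, χ) ∈ (mulP f B).graph ↔ ∀ n, χ n = (f n : ℂ) * ψ n + B ψ n := by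
  rw [mem_graph_iff_exists]
  constructor
  · rintro ⟨h, rfl⟩ n
    rfl
  · intro h
    have hm : ψ ∈ (mulP f B).domain := by
      have h1 := lp.memℓp (χ - B ψ)
      have h2 : ((χ - B ψ : Ltwo ι) : ι → ℂ) = fun n => (f n : ℂ) * ψ n := by
        funext n
        simp [h]
      rw [h2] at h1
      exact h1
    refine ⟨hm, ?_⟩
    ext n
    rw [mulP_apply, h]

theorem mem_graph_sub {E : Type*} [AddCommGroup E] [Module ℂ E] {A B : E →ₗ.[ℂ] E} {ψ χ : E} :
    (ψ, χ) ∈ (A - B).graph ↔ ∃ a b, (ψ, a) ∈ A.graph ∧ (ψ, b) ∈ B.graph ∧ χ = a - b := by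
  simp only [mem_graph_iff_exists]
  constructor
  · rintro ⟨h, rfl⟩
    exact ⟨_, _, ⟨h.1, rfl⟩, ⟨h.2, rfl⟩, rfl⟩
  · rintro ⟨a, b, ⟨h1, rfl⟩, ⟨h2, rfl⟩, rfl⟩
    exact ⟨⟨h1, h2⟩, rfl⟩

section Feshbach

variable {E : Type*} [NormedAddCommGroup E] [NormedSpace ℂ E]

theorem mem_graph_toP {A : E →L[ℂ] E} {ψ χ : E} : (ψ, χ) ∈ (toP A).graph ↔ A ψ = χ := by
  rw [mem_graph_iff_exists]
  exact ⟨fun ⟨_, h⟩ => h, fun h => ⟨trivial, h⟩⟩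

theorem mem_graph_prodP {A B : E →ₗ.[ℂ] E} {ψ χ : E} :
    (ψ, χ) ∈ (prodP A B).graph ↔ ∃ η, (ψ, η) ∈ B.graph ∧ (η, χ) ∈ A.graph := by
  simp only [mem_graph_iff_exists]
  constructor
  · rintro ⟨h, rfl⟩
    obtain ⟨y, hy, rfl⟩ := h
    exact ⟨_, ⟨y.2, rfl⟩, ⟨hy, rfl⟩⟩
  · rintro ⟨η, ⟨h1, rfl⟩, ⟨h2, rfl⟩⟩
    exact ⟨⟨⟨ψ, h1⟩, h2, rfl⟩, rfl⟩

theorem IsBlockInverse.blockInv_eq {Q : E →L[ℂ] E} {K : E →ₗ.[ℂ] E} {R : E →L[ℂ] E}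
    (hQ : Q * Q = Q) (h : IsBlockInverse Q K R) : blockInv Q K = R := by
  have hb : BlockInvertible Q K := ⟨R, h⟩
  rw [blockInv, dif_pos hb]
  exact hb.choose_spec.unique hQ h

end Feshbach

theorem sandwich_mulP {P : Ltwo ι →L[ℂ] Ltwo ι} {p : ι → ℝ} (hP : IsDiag P p)
    (hp : ∀ n, p n * p n = p n) (f : ι → ℝ) (B : Ltwo ι →L[ℂ] Ltwo ι) :
    sandwich P (mulP f B) = mulP (fun n => p n * f n) (P * B * P) := by
  refine pmap_ext_of_graph fun ψ χ => ?_
  simp only [sandwich, mem_graph_prodP, mem_graph_toP, mem_graph_mulP]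
  have hp' : ∀ n, (p n : ℂ) * p n = p n := fun n => by exact_mod_cast hp n
  constructor
  · rintro ⟨ζ, ⟨η, rfl, h⟩, rfl⟩ n
    rw [hP, h, hP]
    simp only [mul_apply_eq_comp]
    rw [hP]
    push_cast
    linear_combination (f n : ℂ) * ψ n * hp' n
  · intro h
    -- This vector is `f P ψ + B P ψ`; its first summand equals `χ - P B P ψ` and is therefore
    -- square summable.
    refine ⟨χ - (P * B * P) ψ + B (P ψ), ⟨P ψ, rfl, fun n => ?_⟩, ?_⟩
    · simp only [lp.coeFn_add, lp.coeFn_sub, Pi.add_apply, Pi.sub_apply, h, hP ψ]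
      push_cast
      ring
    · ext n
      rw [hP]
      simp only [lp.coeFn_add, lp.coeFn_sub, Pi.add_apply, Pi.sub_apply, h,
        mul_apply_eq_comp]
      rw [hP]
      push_cast
      linear_combination (f n : ℂ) * ψ n * hp' n

theorem mulP_sub_toP (f : ι → ℝ) (B C : Ltwo ι →L[ℂ] Ltwo ι) :
    mulP f B - toP C = mulP f (B - C) := by
  refine pmap_ext_of_graph fun ψ χ => ?_
  simp only [mem_graph_sub, mem_graph_toP, mem_graph_mulP]
  constructor
  · rintro ⟨a, b, h, rfl, rfl⟩ n
    simp [h, add_sub_assoc]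
  · intro h
    refine ⟨χ + C ψ, _, fun n => ?_, rfl, by simp⟩
    simp [h, add_assoc]

/-- Multiplication by `f` commutes with `Q`, so the block on the range of `Q` is multiplication by
`f + β`, and `ρ` is its reciprocal there. -/
theorem isBlockInverse_mulP {Q B R : Ltwo ι →L[ℂ] Ltwo ι} {q f β ρ : ι → ℝ} (hQ : IsDiag Q q)
    (hq : ∀ n, q n * q n = q n) (hB : IsDiag (Q * B * Q) β) (hR : IsDiag R ρ)
    (hqρ : ∀ n, q n * ρ n = ρ n) (hβ : ∀ n, ρ n * (f n + β n) = q n) :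
    IsBlockInverse Q (mulP f B) R := by
  have hQR : Q * R = R := ((hQ.mul hR).congr hqρ).eq hR
  have hRQ : R * Q = R := ((hR.mul hQ).congr fun n => by rw [mul_comm, hqρ]).eq hR
  have hQBR : IsDiag (Q * B * R) (fun n => β n * ρ n) := by
    rw [← hQR, ← mul_assoc]
    exact hB.mul hR
  have hRBQ : ∀ ψ n, q n * ρ n * B (Q ψ) n = (β n * ρ n : ℂ) * ψ n := by
    intro ψ n
    have h := (hR.mul hB) ψ n
    simp only [mul_apply_eq_comp] at h
    rw [hR, hQ] at h
    rw [mul_comm (q n : ℂ), mul_assoc, h]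
    push_cast
    ring
  have hqρ' : ∀ n, (q n : ℂ) * ρ n = ρ n := fun n => by exact_mod_cast hqρ n
  have hβ' : ∀ n, (ρ n : ℂ) * (f n + β n) = q n := fun n => by exact_mod_cast hβ n
  -- Puts `R ψ` in the domain: by `hβ`, `f R ψ = Q ψ - Q B R ψ`, a vector of ℓ².
  have hg : ∀ ψ, (R ψ, Q ψ - (Q * B * R) ψ + B (R ψ)) ∈ (mulP f B).graph := by
    intro ψ
    rw [mem_graph_mulP]
    intro n
    simp only [lp.coeFn_add, lp.coeFn_sub, Pi.add_apply, Pi.sub_apply]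
    rw [hQ, hQBR, hR]
    push_cast
    linear_combination (-ψ n) * hβ' n
  refine ⟨by rw [hQR, hRQ], fun ψ => ?_, fun ψ hψ => ?_⟩
  · obtain ⟨h1, h2⟩ := (mem_graph_iff_exists _ _ _).1 (hg ψ)
    refine ⟨h1, ?_⟩
    rw [h2, map_add, map_sub]
    have e1 : Q (Q ψ) = Q ψ := by
      ext n
      rw [hQ, hQ, ← mul_assoc]
      congr 1
      exact_mod_cast hq n
    have e2 : Q ((Q * B * R) ψ) = Q (B (R ψ)) := by
      ext n
      simp only [mul_apply_eq_comp]
      rw [hQ, hQ, ← mul_assoc]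
      congr 1
      exact_mod_cast hq n
    rw [e1, e2, sub_add_cancel]
  · ext n
    have hψn : (ψ : Ltwo ι) n = q n * (ψ : Ltwo ι) n := by
      rw [← hQ, hψ]
    have h3 := hRBQ ψ n
    rw [hψ, hqρ'] at h3
    rw [hR, mulP_apply, mul_add, h3]
    linear_combination (ψ : Ltwo ι) n * hβ' n - hψn

/-- Multiplication by `f` is block diagonal, so only the bounded `B` couples the two blocks; the
correction is the bounded operator `P B R B P` and leaves the domain of the sandwiched operator
unchanged. -/
theorem feshbach_mulP {P Q B R : Ltwo ι →L[ℂ] Ltwo ι} {p q f β ρ : ι → ℝ} (hP : IsDiag P p)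
    (hp : ∀ n, p n * p n = p n) (hQ : IsDiag Q q) (hq : ∀ n, q n * q n = q n)
    (hpq : ∀ n, p n * q n = 0) (hB : IsDiag (Q * B * Q) β) (hR : IsDiag R ρ)
    (hqρ : ∀ n, q n * ρ n = ρ n) (hβ : ∀ n, ρ n * (f n + β n) = q n) :
    feshbach P Q (mulP f B) =
      mulP (fun n => p n * f n) (P * B * P - P * B * R * B * P) := by
  have hinv := isBlockInverse_mulP hQ hq hB hR hqρ hβ
  have hQQ : Q * Q = Q := ((hQ.mul hQ).congr hq).eq hQ
  have hQR : Q * R = R := ((hQ.mul hR).congr hqρ).eq hR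
  have hRQ : R * Q = R := ((hR.mul hQ).congr fun n => by rw [mul_comm, hqρ]).eq hR
  have hqp' : ∀ n, (q n : ℂ) * p n = 0 := fun n => by
    rw [mul_comm]; exact_mod_cast hpq n
  have hqρ' : ∀ n, (q n : ℂ) * ρ n = ρ n := fun n => by exact_mod_cast hqρ n
  rw [feshbach, hinv.blockInv_eq hQQ, sandwich_mulP hP hp, ← mulP_sub_toP]
  refine pmap_ext_of_graph fun ψ χ => ?_
  simp only [mem_graph_sub, mem_graph_prodP, mem_graph_toP, mem_graph_mulP]
  -- The unbounded parts drop out of both applications of the operator, since `R f P = 0` and `P f R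
  -- = 0`.
  have key : ∀ ζ₁ ζ₂ : Ltwo ι, (∀ n, ζ₁ n = (f n : ℂ) * P ψ n + B (P ψ) n) →
      (∀ n, ζ₂ n = (f n : ℂ) * Q (R (Q ζ₁)) n + B (Q (R (Q ζ₁))) n) →
      P ζ₂ = (P * B * R * B * P) ψ := by
    intro ζ₁ ζ₂ h1 h2
    have e1 : Q (R (Q ζ₁)) = R (B (P ψ)) := by
      change (Q * R * Q) ζ₁ = _
      rw [hQR, hRQ]
      ext n
      rw [hR, hR, h1, hP]
      linear_combination (-(f n : ℂ) * p n * ψ n) * hqρ' n + (f n : ℂ) * ρ n * ψ n * hqp' n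
    rw [e1] at h2
    ext n
    simp only [mul_apply_eq_comp]
    rw [hP, hP, h2, hR]
    linear_combination (-(p n : ℂ) * f n * (B (P ψ)) n) * hqρ' n
      + (f n : ℂ) * ρ n * (B (P ψ)) n * hqp' n
  constructor
  · rintro ⟨a, b, ha, ⟨ζ₂, ⟨_, ⟨_, ⟨_, ⟨ζ₁, ⟨_, rfl, h1⟩, rfl⟩, rfl⟩, rfl⟩, h2⟩, rfl⟩, rfl⟩
    exact ⟨a, _, ha, (key ζ₁ ζ₂ h1 h2).symm, rfl⟩
  · rintro ⟨a, b, ha, rfl, rfl⟩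
    have hζ : ∃ ζ₁ : Ltwo ι, ∀ n, ζ₁ n = (f n : ℂ) * P ψ n + B (P ψ) n := by
      refine ⟨a - (P * B * P) ψ + B (P ψ), fun n => ?_⟩
      simp only [lp.coeFn_add, lp.coeFn_sub, Pi.add_apply, Pi.sub_apply, ha, hP ψ]
      push_cast
      ring
    obtain ⟨ζ₁, h1⟩ := hζ
    -- `R` takes its values in the domain, so the second application is always defined.
    have hζ2 : ∃ ζ₂ : Ltwo ι, ∀ n,
        ζ₂ n = (f n : ℂ) * Q (R (Q ζ₁)) n + B (Q (R (Q ζ₁))) n := by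
      obtain ⟨h3, _⟩ := hinv.right_inv (Q ζ₁)
      have e : Q (R (Q ζ₁)) = R (Q ζ₁) := by
        change (Q * R) _ = _
        rw [hQR]
      refine ⟨mulP f B ⟨_, h3⟩, fun n => ?_⟩
      rw [mulP_apply, e]
    obtain ⟨ζ₂, h2⟩ := hζ2
    exact ⟨a, _, ha, ⟨ζ₂, ⟨_, ⟨_, ⟨_, ⟨ζ₁, ⟨_, rfl, h1⟩, rfl⟩, rfl⟩, rfl⟩, h2⟩, rfl⟩,
      by rw [key ζ₁ ζ₂ h1 h2]⟩

theorem single_mem_mulP_domain [DecidableEq ι] (f : ι → ℝ) (B : Ltwo ι →L[ℂ] Ltwo ι) (i : ι)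
    (c : ℂ) : (lp.single 2 i c : Ltwo ι) ∈ (mulP f B).domain := by
  have h : (lp.single 2 i c, lp.single 2 i ((f i : ℂ) * c) + B (lp.single 2 i c)) ∈
      (mulP f B).graph := by
    rw [mem_graph_mulP]
    intro n
    simp only [lp.coeFn_add, Pi.add_apply, lp.coeFn_single]
    by_cases hn : n = i
    · subst hn; simp
    · simp [hn]
  exact ((mem_graph_iff_exists _ _ _).1 h).1

theorem dense_mulP_domain (f : ι → ℝ) (B : Ltwo ι →L[ℂ] Ltwo ι) :
    Dense ((mulP f B).domain : Set (Ltwo ι)) := by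
  classical
  intro ψ
  refine mem_closure_of_tendsto (lp.hasSum_single (by simp) ψ) (Eventually.of_forall fun s => ?_)
  exact Submodule.sum_mem _ fun i _ => single_mem_mulP_domain f B i _

/-- Symmetry is checked coordinatewise, using that of `B`. Conversely, pairing an element of the
adjoint's graph with basis vectors, which lie in the domain, gives the coordinate formula, and by
`mem_graph_mulP` this is already membership in the graph. -/
theorem isSelfAdjoint_mulP (f : ι → ℝ) {B : Ltwo ι →L[ℂ] Ltwo ι} (hB : IsSelfAdjoint B) :
    IsSelfAdjoint (mulP f B) := by
  classical
  rw [LinearPMap.isSelfAdjoint_def]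
  have hBs : ∀ ψ χ, inner ℂ (B ψ) χ = inner ℂ ψ (B χ) := fun ψ χ => hB.isSymmetric ψ χ
  have hd := dense_mulP_domain f B
  refine le_antisymm ?_ (LinearPMap.IsFormalAdjoint.le_adjoint hd fun ψ χ => ?_)
  · rw [← LinearPMap.le_graph_iff]
    rintro ⟨ψ, χ⟩ h
    obtain ⟨h1, h2⟩ := (mem_graph_iff_exists _ _ _).1 h
    rw [mem_graph_mulP]
    intro n
    obtain ⟨y, hy⟩ : ∃ y : (mulP f B).domain, (y : Ltwo ι) = lp.single 2 n 1 :=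
      ⟨⟨_, single_mem_mulP_domain f B n 1⟩, rfl⟩
    have h3 := LinearPMap.adjoint_isFormalAdjoint hd ⟨ψ, h1⟩ y
    have h4 : mulP f B y = lp.single 2 n (f n : ℂ) + B (lp.single 2 n 1) := by
      ext m
      rw [mulP_apply, hy, lp.coeFn_add, Pi.add_apply, lp.coeFn_single, lp.coeFn_single]
      by_cases hm : m = n
      · subst hm; simp
      · simp [hm]
    rw [h2, h4, hy] at h3
    simp only [inner_add_right, ← hBs, lp.inner_single_right] at h3
    simp only [RCLike.inner_apply, one_mul] at h3
    have h5 := congrArg (starRingEnd ℂ) h3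
    simpa using h5
  · rw [lp.inner_eq_tsum, lp.inner_eq_tsum]
    have h1 := (hBs ψ χ)
    have key : inner ℂ (mulP f B ψ - B ψ.1) χ.1 = inner ℂ ψ.1 (mulP f B χ - B χ.1) := by
      rw [lp.inner_eq_tsum, lp.inner_eq_tsum]
      refine tsum_congr fun n => ?_
      simp only [lp.coeFn_sub, Pi.sub_apply, mulP_apply, add_sub_cancel_right,
        RCLike.inner_apply, map_mul, Complex.conj_ofReal]
      ring
    rw [inner_sub_left, inner_sub_right, h1] at key
    rw [← lp.inner_eq_tsum, ← lp.inner_eq_tsum]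
    exact sub_left_injective key

end Multiplication

theorem mulP_eq_mulP_sub {ι : Type*} {f g : ι → ℝ} {B D : Ltwo ι →L[ℂ] Ltwo ι}
    (hD : IsDiag D g) : mulP f (B - D) = mulP (fun n => f n - g n) B := by
  refine pmap_ext_of_graph fun ψ χ => ?_
  simp only [mem_graph_mulP]
  refine forall_congr' fun n => ?_
  rw [sub_apply, lp.coeFn_sub, Pi.sub_apply, hD]
  push_cast
  ring_nf

/-! ### The Hamiltonian in the occupation number basis: pair shifts and matrix elements. -/

theorem cre_ann_apply {d : ℕ} (l : Mode d) (ψ : Amp d) (n : Occ d) :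
    cre l (ann l ψ) n = ((n l : ℝ) : ℂ) * ψ n := by
  by_cases h : n l = 0
  · simp [cre, h]
  · have h1 : (n - Finsupp.single l 1 : Occ d) l + 1 = n l := by
      simp
      omega
    change (Real.sqrt (n l : ℝ) : ℂ) *
      ((Real.sqrt (((n - Finsupp.single l 1 : Occ d) l : ℕ) + 1) : ℂ) *
        ψ (n - Finsupp.single l 1 + Finsupp.single l 1)) = _
    rw [tsub_single_add_single h, ← mul_assoc, ← Complex.ofReal_mul]
    congr 2
    rw [show (((n - Finsupp.single l 1 : Occ d) l : ℕ) : ℝ) + 1 = (n l : ℝ) by exact_mod_cast h1]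
    exact Real.mul_self_sqrt (Nat.cast_nonneg _)

theorem extend_apply {d N : ℕ} (ψ : Config d N → ℂ) (n : Config d N) :
    extend d N ψ n.1 = ψ n := by
  simp [extend, n.2]

theorem mem_graph_sectorOp {d N : ℕ} {T : Amp d →ₗ[ℂ] Amp d} {ψ χ : FockN d N} :
    (ψ, χ) ∈ (sectorOp N T).graph ↔ ∀ n : Config d N, χ n = T (extend d N ψ) n.1 := by
  rw [mem_graph_iff_exists]
  constructor
  · rintro ⟨h, rfl⟩ n
    rfl
  · intro h
    have h1 : ((χ : FockN d N) : Config d N → ℂ) = sectorMap N T ψ := funext h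
    refine ⟨?_, ?_⟩
    · have := lp.memℓp χ
      rw [h1] at this
      exact this
    · exact Subtype.ext h1.symm

namespace ThreeModes

variable {d : ℕ} (S : ThreeModes d)

theorem neg_j_ne_j : -S.j ≠ S.j := fun h => S.j_ne_zero (self_eq_neg.1 h.symm)

/-- The number of particles in the modes `±j`. -/
def pairCount (n : Config d S.N) : ℕ := n.1 S.j + n.1 (-S.j)

/-- The diagonal part of the Hamiltonian. -/
def energy (n : Config d S.N) : ℝ :=
  (∑ l ∈ n.1.support with l ≠ S.j ∧ l ≠ -S.j, S.ksq l * n.1 l) +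
    (S.ksq S.j + S.phi / S.N * n.1 0) * S.pairCount n

/-- The configuration with a pair moved from the zero mode to the modes `±j`, if possible. -/
def up (n : Config d S.N) : Config d S.N :=
  if h : 2 ≤ n.1 0 then
    ⟨n.1 - Finsupp.single 0 1 - Finsupp.single 0 1 + Finsupp.single S.j 1 +
      Finsupp.single (-S.j) 1, by
      have h1 : n.1 0 ≠ 0 := by omega
      have h2 : (n.1 - Finsupp.single 0 1 : Occ d) 0 ≠ 0 := by simp; omega
      have h3 := n.2
      rw [← tsub_single_add_single h1, ← tsub_single_add_single h2] at h3
      simp only [map_add, Finsupp.degree_single] at h3 ⊢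
      exact h3⟩
  else n

/-- The configuration with a pair moved from the modes `±j` to the zero mode, if possible. -/
def down (n : Config d S.N) : Config d S.N :=
  if h : n.1 S.j ≠ 0 ∧ n.1 (-S.j) ≠ 0 then
    ⟨n.1 + Finsupp.single 0 1 + Finsupp.single 0 1 - Finsupp.single S.j 1 -
      Finsupp.single (-S.j) 1, by
      have h1 : (n.1 + Finsupp.single 0 1 + Finsupp.single 0 1 : Occ d) S.j ≠ 0 := by simp [h.1]
      have h2 : (n.1 + Finsupp.single 0 1 + Finsupp.single 0 1 - Finsupp.single S.j 1 : Occ d) (-S.j)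
          ≠ 0 := by
        simp [h.2, Finsupp.single_eq_of_ne S.neg_j_ne_j]
      have h3 : (n.1 + Finsupp.single 0 1 + Finsupp.single 0 1).degree = S.N + 1 + 1 := by
        simp [n.2]
      rw [← tsub_single_add_single h1, ← tsub_single_add_single h2] at h3
      simp only [map_add, Finsupp.degree_single] at h3 ⊢
      omega⟩
  else n

/-- The matrix element of `W` at `n`. -/
def coefW (n : Config d S.N) : ℝ :=
  S.phi / S.N * (Real.sqrt (n.1 0) * Real.sqrt ((n.1 0 - 1 : ℕ)) * Real.sqrt (n.1 S.j + 1) *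
    Real.sqrt (n.1 (-S.j) + 1))

/-- The matrix element of `W^*` at `n`. -/
def coefWstar (n : Config d S.N) : ℝ :=
  S.phi / S.N * (Real.sqrt (n.1 0 + 1) * Real.sqrt (n.1 0 + 1 + 1) * Real.sqrt (n.1 S.j) *
    Real.sqrt (n.1 (-S.j)))

/-- With `coefWstar_eq_zero`, this makes the default values of `up` and `down` harmless: where no
pair can be moved, the weight vanishes. -/
theorem coefW_eq_zero {n : Config d S.N} (h : ¬ 2 ≤ n.1 0) : S.coefW n = 0 := by
  have : n.1 0 - 1 = 0 := by omega
  simp [coefW, this]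

theorem coefWstar_eq_zero {n : Config d S.N} (h : ¬ (n.1 S.j ≠ 0 ∧ n.1 (-S.j) ≠ 0)) :
    S.coefWstar n = 0 := by
  rw [not_and_or, not_not, not_not] at h
  rcases h with h | h <;> simp [coefWstar, h]

theorem up_val {n : Config d S.N} (h : 2 ≤ n.1 0) :
    (S.up n).1 = n.1 - Finsupp.single 0 1 - Finsupp.single 0 1 + Finsupp.single S.j 1 +
      Finsupp.single (-S.j) 1 := by
  rw [up, dif_pos h]

theorem down_val {n : Config d S.N} (h : n.1 S.j ≠ 0 ∧ n.1 (-S.j) ≠ 0) :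
    (S.down n).1 = n.1 + Finsupp.single 0 1 + Finsupp.single 0 1 - Finsupp.single S.j 1 -
      Finsupp.single (-S.j) 1 := by
  rw [down, dif_pos h]

theorem up_zero {n : Config d S.N} (h : 2 ≤ n.1 0) : (S.up n).1 0 + 2 = n.1 0 := by
  rw [S.up_val h]
  have h1 : (-S.j) ≠ 0 := neg_ne_zero.2 S.j_ne_zero
  simp [Finsupp.single_eq_of_ne S.j_ne_zero.symm, Finsupp.single_eq_of_ne h1.symm]
  omega

theorem up_j {n : Config d S.N} (h : 2 ≤ n.1 0) : (S.up n).1 S.j = n.1 S.j + 1 := by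
  rw [S.up_val h]
  simp [Finsupp.single_eq_of_ne S.j_ne_zero, Finsupp.single_eq_of_ne S.neg_j_ne_j.symm]

theorem up_neg_j {n : Config d S.N} (h : 2 ≤ n.1 0) : (S.up n).1 (-S.j) = n.1 (-S.j) + 1 := by
  rw [S.up_val h]
  have h1 : (-S.j) ≠ 0 := neg_ne_zero.2 S.j_ne_zero
  simp [Finsupp.single_eq_of_ne h1, Finsupp.single_eq_of_ne S.neg_j_ne_j]

theorem pairCount_up {n : Config d S.N} (h : 2 ≤ n.1 0) :
    S.pairCount (S.up n) = S.pairCount n + 2 := by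
  rw [pairCount, pairCount, S.up_j h, S.up_neg_j h]
  omega

theorem down_up {n : Config d S.N} (h : 2 ≤ n.1 0) : S.down (S.up n) = n := by
  have h1 : (S.up n).1 S.j ≠ 0 ∧ (S.up n).1 (-S.j) ≠ 0 := by
    rw [S.up_j h, S.up_neg_j h]; simp
  apply Subtype.ext
  rw [S.down_val h1, S.up_val h]
  have e1 : n.1 0 ≠ 0 := by omega
  have e2 : (n.1 - Finsupp.single 0 1 : Occ d) 0 ≠ 0 := by simp; omega
  have e3 : n.1 = n.1 - Finsupp.single 0 1 - Finsupp.single 0 1 + Finsupp.single 0 1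
      + Finsupp.single 0 1 := by
    rw [tsub_single_add_single e2, tsub_single_add_single e1]
  conv_rhs => rw [e3]
  generalize n.1 - Finsupp.single 0 1 - Finsupp.single 0 1 = m
  rw [tsub_tsub]
  rw [show m + Finsupp.single S.j 1 + Finsupp.single (-S.j) 1 + Finsupp.single 0 1 +
    Finsupp.single 0 1 = m + Finsupp.single 0 1 + Finsupp.single 0 1 +
      (Finsupp.single S.j 1 + Finsupp.single (-S.j) 1) by abel]
  exact add_tsub_cancel_right _ _

theorem down_zero {n : Config d S.N} (h : n.1 S.j ≠ 0 ∧ n.1 (-S.j) ≠ 0) :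
    (S.down n).1 0 = n.1 0 + 2 := by
  rw [S.down_val h]
  have h1 : (-S.j) ≠ 0 := neg_ne_zero.2 S.j_ne_zero
  simp [Finsupp.single_eq_of_ne S.j_ne_zero.symm, Finsupp.single_eq_of_ne h1.symm]

theorem up_down {n : Config d S.N} (h : n.1 S.j ≠ 0 ∧ n.1 (-S.j) ≠ 0) :
    S.up (S.down n) = n := by
  have h1 : 2 ≤ (S.down n).1 0 := by rw [S.down_zero h]; omega
  apply Subtype.ext
  rw [S.up_val h1, S.down_val h]
  have e2 : (n.1 - Finsupp.single S.j 1 : Occ d) (-S.j) ≠ 0 := by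
    simp [Finsupp.single_eq_of_ne S.neg_j_ne_j, h.2]
  obtain ⟨m, hm⟩ : ∃ m, n.1 = m + Finsupp.single (-S.j) 1 + Finsupp.single S.j 1 :=
    ⟨_, by rw [tsub_single_add_single e2, tsub_single_add_single h.1]⟩
  rw [hm]
  rw [show m + Finsupp.single (-S.j) 1 + Finsupp.single S.j 1 + Finsupp.single 0 1 +
    Finsupp.single 0 1 = m + Finsupp.single 0 1 + Finsupp.single 0 1 + Finsupp.single (-S.j) 1 +
      Finsupp.single S.j 1 by abel]
  rw [add_tsub_cancel_right, add_tsub_cancel_right, add_tsub_cancel_right, add_tsub_cancel_right]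
  abel

theorem coefWstar_up {n : Config d S.N} (h : 2 ≤ n.1 0) :
    S.coefWstar (S.up n) = S.coefW n := by
  have h0 := S.up_zero h
  rw [coefWstar, coefW, S.up_j h, S.up_neg_j h]
  have e1 : (n.1 0 - 1 : ℕ) = (S.up n).1 0 + 1 := by omega
  have e2 : (n.1 0 : ℝ) = (S.up n).1 0 + 1 + 1 := by exact_mod_cast h0.symm
  rw [e1, e2]
  push_cast
  ring

theorem coefW_down {n : Config d S.N} (h : n.1 S.j ≠ 0 ∧ n.1 (-S.j) ≠ 0) :
    S.coefW (S.down n) = S.coefWstar n := by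
  have h1 : 2 ≤ (S.down n).1 0 := by rw [S.down_zero h]; omega
  rw [← S.coefWstar_up h1, S.up_down h]

theorem coefW_sq (n : Config d S.N) :
    S.coefW n ^ 2 = (S.phi / S.N) ^ 2 *
      ((n.1 0 : ℝ) * (n.1 0 - 1) * (n.1 S.j + 1) * (n.1 (-S.j) + 1)) := by
  by_cases h : 2 ≤ n.1 0
  · have e : ((n.1 0 - 1 : ℕ) : ℝ) = (n.1 0 : ℝ) - 1 := by
      rw [Nat.cast_sub (by omega)]; simp
    rw [coefW, mul_pow, mul_pow, mul_pow, mul_pow, Real.sq_sqrt (by positivity),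
      Real.sq_sqrt (by positivity), Real.sq_sqrt (by positivity), Real.sq_sqrt (by positivity), e]
  · rw [S.coefW_eq_zero h]
    -- At `n 0 = 0` truncated and real subtraction disagree, but the factor `n 0` kills the product.
    have : n.1 0 = 0 ∨ n.1 0 = 1 := by omega
    rcases this with h | h <;> simp [h]

theorem W_apply (ψ : FockN d S.N) (n : Config d S.N) :
    S.W ψ n = (S.coefW n : ℂ) * ψ (S.up n) := by
  have h0 : S.W ψ n = S.WAmp (extend d S.N ψ) n.1 := rfl
  have h1 : (-S.j) ≠ 0 := neg_ne_zero.2 S.j_ne_zero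
  have h2 : S.WAmp (extend d S.N ψ) n.1 = (S.coefW n : ℂ) *
      extend d S.N ψ (n.1 - Finsupp.single 0 1 - Finsupp.single 0 1 + Finsupp.single S.j 1 +
      Finsupp.single (-S.j) 1) := by
    simp [WAmp, cre, ann, coefW, Finsupp.single_eq_of_ne S.j_ne_zero,
      Finsupp.single_eq_of_ne h1, Finsupp.single_eq_of_ne S.neg_j_ne_j]
    ring
  rw [h0, h2]
  by_cases h : 2 ≤ n.1 0
  · rw [← S.up_val h, extend_apply]
  · rw [S.coefW_eq_zero h]; simp

theorem Wstar_apply (ψ : FockN d S.N) (n : Config d S.N) :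
    S.Wstar ψ n = (S.coefWstar n : ℂ) * ψ (S.down n) := by
  have h0 : S.Wstar ψ n = S.WstarAmp (extend d S.N ψ) n.1 := rfl
  have h1 : (-S.j) ≠ 0 := neg_ne_zero.2 S.j_ne_zero
  have h2 : S.WstarAmp (extend d S.N ψ) n.1 = (S.coefWstar n : ℂ) *
      extend d S.N ψ (n.1 + Finsupp.single 0 1 + Finsupp.single 0 1 - Finsupp.single S.j 1 -
      Finsupp.single (-S.j) 1) := by
    simp [WstarAmp, cre, ann, coefWstar, Finsupp.single_eq_of_ne S.j_ne_zero,
      Finsupp.single_eq_of_ne h1, Finsupp.single_eq_of_ne S.neg_j_ne_j]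
    ring
  rw [h0, h2]
  by_cases h : n.1 S.j ≠ 0 ∧ n.1 (-S.j) ≠ 0
  · rw [← S.down_val h, extend_apply]
  · rw [S.coefWstar_eq_zero h]; simp

/-- Coordinate `a` of `star W χ` is the pairing of `W e_a` with `χ`, and `W e_a` is a multiple of
the basis vector at `down a`, or zero if ±j hold no pair to remove. -/
theorem adjoint_W : star S.W = S.Wstar := by
  classical
  ext χ a
  have h : inner ℂ (lp.single 2 a (1 : ℂ)) (star S.W χ) =
      inner ℂ (S.W (lp.single 2 a (1 : ℂ))) χ := by
    rw [ContinuousLinearMap.star_eq_adjoint, ContinuousLinearMap.adjoint_inner_right]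
  rw [lp.inner_single_left] at h
  simp only [RCLike.inner_apply, map_one, mul_one] at h
  rw [h, Wstar_apply]
  by_cases ha : a.1 S.j ≠ 0 ∧ a.1 (-S.j) ≠ 0
  · have hW : S.W (lp.single 2 a (1 : ℂ)) = lp.single 2 (S.down a) (S.coefWstar a : ℂ) := by
      ext n
      rw [W_apply, lp.coeFn_single, lp.coeFn_single]
      by_cases hn : n = S.down a
      · subst hn
        rw [S.up_down ha, S.coefW_down ha]
        simp
      · rw [Pi.single_eq_of_ne hn]
        by_cases h2 : 2 ≤ n.1 0
        · rw [Pi.single_eq_of_ne, mul_zero]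
          rintro rfl
          exact hn (S.down_up h2).symm
        · rw [S.coefW_eq_zero h2]; simp
    rw [hW, lp.inner_single_left]
    simp [mul_comm]
  · have hW : S.W (lp.single 2 a (1 : ℂ)) = 0 := by
      ext n
      rw [W_apply, lp.coeFn_single]
      by_cases h2 : 2 ≤ n.1 0
      · rw [Pi.single_eq_of_ne, mul_zero]
        · rfl
        · rintro rfl
          apply ha
          rw [S.up_j h2, S.up_neg_j h2]
          simp
      · rw [S.coefW_eq_zero h2]; simp
    rw [hW, S.coefWstar_eq_zero ha]
    simp

theorem adjoint_Wstar : star S.Wstar = S.W := by rw [← S.adjoint_W, star_star]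

/-- `W` and `W*` are bounded, so the maximal domain of the Hamiltonian is that of its diagonal part.
-/
theorem HBog_eq : S.HBog = mulP S.energy (S.W + S.Wstar) := by
  refine pmap_ext_of_graph fun ψ χ => ?_
  rw [HBog, mem_graph_sectorOp, mem_graph_mulP]
  refine forall_congr' fun n => ?_
  have hk : S.kinAmp (extend d S.N ψ) n.1 =
      ((∑ l ∈ n.1.support with l ≠ S.j ∧ l ≠ -S.j, S.ksq l * n.1 l : ℝ) : ℂ) * ψ n := by
    change ∑ l ∈ n.1.support with l ≠ S.j ∧ l ≠ -S.j, ((S.ksq l : ℝ) : ℂ) *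
      cre l (ann l (extend d S.N ψ)) n.1 = _
    rw [Complex.ofReal_sum, Finset.sum_mul]
    refine Finset.sum_congr rfl fun l _ => ?_
    rw [cre_ann_apply, extend_apply]
    push_cast
    ring
  have h0 : S.H0Amp (extend d S.N ψ) n.1 =
      (((S.ksq S.j + S.phi / S.N * n.1 0) * S.pairCount n : ℝ) : ℂ) * ψ n := by
    simp only [H0Amp, LinearMap.comp_apply, LinearMap.add_apply, LinearMap.smul_apply,
      LinearMap.id_apply, Pi.add_apply, Pi.smul_apply, map_add, cre_ann_apply, extend_apply,
      smul_eq_mul, pairCount]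
    push_cast
    ring
  have e : (S.kinAmp + (S.H0Amp + S.WAmp + S.WstarAmp)) (extend d S.N ψ) n.1 =
      S.kinAmp (extend d S.N ψ) n.1 + (S.H0Amp (extend d S.N ψ) n.1 + S.W ψ n + S.Wstar ψ n) := rfl
  rw [e, hk, h0, add_apply, lp.coeFn_add, Pi.add_apply, energy]
  push_cast
  ring_nf

theorem HSub_eq (z : ℝ) : S.HSub z = mulP (fun n => S.energy n - z) (S.W + S.Wstar) := by
  rw [HSub, HBog_eq, mulP_sub_toP]
  refine mulP_eq_mulP_sub fun ψ n => ?_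
  rw [smul_apply, one_apply_eq_self, lp.coeFn_smul, Pi.smul_apply, smul_eq_mul]

/-! ### Projections onto the sectors of given occupation of ±j. -/

open Classical in
theorem isDiag_proj (A : Set (Occ d)) :
    IsDiag (S.proj A) (fun n => if n.1 ∈ A then 1 else 0) := by
  intro ψ n
  change (if n.1 ∈ A then extend d S.N ψ n.1 else 0) = _
  rw [extend_apply]
  by_cases h : n.1 ∈ A <;> simp only [h, if_true, if_false] <;> simp

/-- The characteristic function of the range of `Q^{(i,i+1)}`. -/
def qInd (i : ℕ) (n : Config d S.N) : ℝ :=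
  if S.pairCount n + i = S.N ∨ S.pairCount n + (i + 1) = S.N then 1 else 0

/-- The characteristic function of the range of `Q^{(>i+1)}`. -/
def pInd (i : ℕ) (n : Config d S.N) : ℝ := if S.pairCount n + (i + 1) < S.N then 1 else 0

theorem isDiag_Q (i : ℕ) : IsDiag (S.Q i) (S.qInd i) := by
  refine (S.isDiag_proj _).congr fun n => ?_
  rw [qInd]
  congr

theorem isDiag_QGt (i : ℕ) : IsDiag (S.QGt i) (S.pInd i) := by
  refine (S.isDiag_proj _).congr fun n => ?_
  rw [pInd]
  congr

theorem qInd_mul_self (i : ℕ) (n : Config d S.N) : S.qInd i n * S.qInd i n = S.qInd i n := by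
  rw [qInd]; split_ifs <;> simp

theorem pInd_mul_self (i : ℕ) (n : Config d S.N) : S.pInd i n * S.pInd i n = S.pInd i n := by
  rw [pInd]; split_ifs <;> simp

theorem pInd_mul_qInd (i : ℕ) (n : Config d S.N) : S.pInd i n * S.qInd i n = 0 := by
  rw [pInd, qInd]; split_ifs <;> first | omega | simp

end ThreeModes

theorem IsDiag.isSelfAdjoint {ι : Type*} {A : Ltwo ι →L[ℂ] Ltwo ι} {f : ι → ℝ}
    (hA : IsDiag A f) : IsSelfAdjoint A := by
  rw [ContinuousLinearMap.isSelfAdjoint_iff_isSymmetric]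
  intro ψ χ
  rw [lp.inner_eq_tsum, lp.inner_eq_tsum]
  refine tsum_congr fun n => ?_
  simp only [ContinuousLinearMap.coe_coe]
  rw [hA, hA]
  simp
  ring

namespace ThreeModes

variable {d : ℕ} (S : ThreeModes d)

theorem ksq_nonneg (l : Mode d) : 0 ≤ S.ksq l := Finset.sum_nonneg fun _ _ => sq_nonneg _

theorem kin_nonneg (n : Config d S.N) :
    0 ≤ ∑ l ∈ n.1.support with l ≠ S.j ∧ l ≠ -S.j, S.ksq l * n.1 l :=
  Finset.sum_nonneg fun l _ => mul_nonneg (S.ksq_nonneg l) (Nat.cast_nonneg _)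

theorem energy_nonneg (n : Config d S.N) : 0 ≤ S.energy n := by
  have h1 := S.kin_nonneg n
  have h2 := S.ksq_nonneg S.j
  have h3 := S.phi_pos
  rw [energy]
  positivity

/-- The diagonal of `R_{i,i}(z)`. -/
def rho (z : ℝ) (i : ℕ) (n : Config d S.N) : ℝ := S.qInd i n * (S.energy n - z)⁻¹

theorem qInd_mul_rho (z : ℝ) (i : ℕ) (n : Config d S.N) :
    S.qInd i n * S.rho z i n = S.rho z i n := by
  rw [rho, ← mul_assoc, qInd_mul_self]

theorem qInd_nonneg (i : ℕ) (n : Config d S.N) : 0 ≤ S.qInd i n := by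
  rw [qInd]; split_ifs <;> simp

theorem qInd_le_one (i : ℕ) (n : Config d S.N) : S.qInd i n ≤ 1 := by
  rw [qInd]; split_ifs <;> simp

section Negative

variable {S} {z : ℝ} (hz : z < 0)

include hz

theorem energy_sub_pos (n : Config d S.N) : 0 < S.energy n - z := by
  have := S.energy_nonneg n
  linarith

theorem rho_nonneg (i : ℕ) (n : Config d S.N) : 0 ≤ S.rho z i n :=
  mul_nonneg (S.qInd_nonneg i n) (inv_nonneg.2 (energy_sub_pos hz n).le)

theorem rho_le (i : ℕ) (n : Config d S.N) : S.rho z i n ≤ (-z)⁻¹ := by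
  have h1 : (S.energy n - z)⁻¹ ≤ (-z)⁻¹ := by
    have := S.energy_nonneg n
    exact inv_anti₀ (by linarith) (by linarith)
  have h2 : 0 ≤ (S.energy n - z)⁻¹ := inv_nonneg.2 (energy_sub_pos hz n).le
  calc S.rho z i n ≤ 1 * (S.energy n - z)⁻¹ :=
        mul_le_mul_of_nonneg_right (S.qInd_le_one i n) h2
    _ ≤ _ := by rwa [one_mul]

end Negative

/-! ### The action of `W` and `W^*` on the sectors -/

/-- The only path goes from `n` to `up n` and back, as `down (up n) = n`; it collects the same
weight twice. -/
theorem isDiag_conj_W {A : FockN d S.N →L[ℂ] FockN d S.N} {g : Config d S.N → ℝ}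
    (hA : IsDiag A g) : IsDiag (S.W * A * S.Wstar) (fun n => S.coefW n ^ 2 * g (S.up n)) := by
  intro ψ n
  simp only [mul_apply_eq_comp]
  rw [W_apply, hA, Wstar_apply]
  by_cases h : 2 ≤ n.1 0
  · rw [S.down_up h, S.coefWstar_up h]
    push_cast
    ring
  · rw [S.coefW_eq_zero h]
    simp

theorem diag_mul_W_mul_eq_zero {A B : FockN d S.N →L[ℂ] FockN d S.N} {f g : Config d S.N → ℝ}
    (hA : IsDiag A f) (hB : IsDiag B g) (h : ∀ n, 2 ≤ n.1 0 → f n * g (S.up n) = 0) :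
    A * S.W * B = 0 := by
  ext ψ n
  simp only [mul_apply_eq_comp]
  rw [hA, W_apply, hB]
  by_cases h2 : 2 ≤ n.1 0
  · have := h n h2
    have h' : (f n : ℂ) * g (S.up n) = 0 := by exact_mod_cast this
    rw [show (f n : ℂ) * (S.coefW n * (g (S.up n) * ψ (S.up n))) =
      (f n * g (S.up n)) * (S.coefW n * ψ (S.up n)) by ring, h']
    simp
  · rw [S.coefW_eq_zero h2]
    simp

theorem diag_mul_Wstar_mul_eq_zero {A B : FockN d S.N →L[ℂ] FockN d S.N}
    {f g : Config d S.N → ℝ} (hA : IsDiag A f) (hB : IsDiag B g)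
    (h : ∀ n, 2 ≤ n.1 0 → g n * f (S.up n) = 0) : A * S.Wstar * B = 0 := by
  have h1 := congrArg star (S.diag_mul_W_mul_eq_zero hB hA h)
  rw [star_mul, star_mul, S.adjoint_W, hA.isSelfAdjoint.star_eq, hB.isSelfAdjoint.star_eq,
    star_zero] at h1
  rw [mul_assoc, h1]

/-- A pair shift changes the occupation by two, whereas the two values admitted by `qInd i` differ
by one. This is why `Q W Q = 0`. -/
theorem qInd_mul_qInd_up (i : ℕ) {n : Config d S.N} (h : 2 ≤ n.1 0) :
    S.qInd i n * S.qInd i (S.up n) = 0 := by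
  rw [qInd, qInd, S.pairCount_up h]
  split_ifs <;> first | omega | simp

theorem qInd_mul_pInd_up (i : ℕ) {n : Config d S.N} (h : 2 ≤ n.1 0) :
    S.qInd i n * S.pInd i (S.up n) = 0 := by
  rw [qInd, pInd, S.pairCount_up h]
  split_ifs <;> first | omega | simp

/-- Starting from `Q^{(i,i+1)}`, `W` reaches only the block eliminated next. -/
theorem pInd_mul_qInd_up (i : ℕ) {n : Config d S.N} (h : 2 ≤ n.1 0) :
    S.pInd i n * S.qInd i (S.up n) = S.qInd (i + 2) n * S.qInd i (S.up n) := by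
  rw [qInd, qInd, pInd, S.pairCount_up h]
  split_ifs <;> first | omega | simp

theorem pInd_mul_pInd_add_two (i : ℕ) (n : Config d S.N) :
    S.pInd (i + 2) n * S.pInd i n = S.pInd (i + 2) n := by
  rw [pInd, pInd]
  split_ifs <;> first | omega | simp

theorem qInd_mul_pInd_add_two (i : ℕ) (n : Config d S.N) :
    S.qInd (i + 2) n * S.pInd i n = S.qInd (i + 2) n := by
  rw [pInd, qInd]
  split_ifs <;> first | omega | simp

theorem Q_mul_self (i : ℕ) : S.Q i * S.Q i = S.Q i :=
  (((S.isDiag_Q i).mul (S.isDiag_Q i)).congr (S.qInd_mul_self i)).eq (S.isDiag_Q i)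

theorem QGt_mul_QGt (i : ℕ) : S.QGt (i + 2) * S.QGt i = S.QGt (i + 2) :=
  (((S.isDiag_QGt _).mul (S.isDiag_QGt i)).congr (S.pInd_mul_pInd_add_two i)).eq (S.isDiag_QGt _)

theorem QGt_mul_QGt' (i : ℕ) : S.QGt i * S.QGt (i + 2) = S.QGt (i + 2) :=
  (((S.isDiag_QGt _).mul (S.isDiag_QGt _)).congr fun n => by
    rw [mul_comm, S.pInd_mul_pInd_add_two i]).eq (S.isDiag_QGt _)

theorem Q_mul_QGt (i : ℕ) : S.Q (i + 2) * S.QGt i = S.Q (i + 2) :=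
  (((S.isDiag_Q _).mul (S.isDiag_QGt i)).congr (S.qInd_mul_pInd_add_two i)).eq (S.isDiag_Q _)

theorem QGt_mul_Q (i : ℕ) : S.QGt i * S.Q (i + 2) = S.Q (i + 2) :=
  (((S.isDiag_QGt i).mul (S.isDiag_Q _)).congr fun n => by
    rw [mul_comm, S.qInd_mul_pInd_add_two i]).eq (S.isDiag_Q _)

theorem Q_W_Q (i : ℕ) : S.Q i * S.W * S.Q i = 0 :=
  S.diag_mul_W_mul_eq_zero (S.isDiag_Q i) (S.isDiag_Q i) fun _ h => S.qInd_mul_qInd_up i h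

theorem Q_Wstar_Q (i : ℕ) : S.Q i * S.Wstar * S.Q i = 0 :=
  S.diag_mul_Wstar_mul_eq_zero (S.isDiag_Q i) (S.isDiag_Q i) fun _ h => S.qInd_mul_qInd_up i h

theorem Q_W_QGt (i : ℕ) : S.Q i * S.W * S.QGt i = 0 :=
  S.diag_mul_W_mul_eq_zero (S.isDiag_Q i) (S.isDiag_QGt i) fun _ h => S.qInd_mul_pInd_up i h

theorem QGt_Wstar_Q (i : ℕ) : S.QGt i * S.Wstar * S.Q i = 0 :=
  S.diag_mul_Wstar_mul_eq_zero (S.isDiag_QGt i) (S.isDiag_Q i) fun _ h => S.qInd_mul_pInd_up i h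

theorem Q_WW_Q (i : ℕ) : S.Q i * (S.W + S.Wstar) * S.Q i = 0 := by
  rw [mul_add, add_mul, Q_W_Q, Q_Wstar_Q, add_zero]

theorem Q_WW_QGt (i : ℕ) :
    S.Q i * (S.W + S.Wstar) * S.QGt i = S.Q i * S.Wstar * S.QGt i := by
  rw [mul_add, add_mul, Q_W_QGt, zero_add]

theorem QGt_WW_Q (i : ℕ) :
    S.QGt i * (S.W + S.Wstar) * S.Q i = S.QGt i * S.W * S.Q i := by
  rw [mul_add, add_mul, QGt_Wstar_Q, add_zero]

/-! ### Resolvents and effective interactions -/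

theorem isBlockInverse_HSub {z : ℝ} (hz : z < 0) (i : ℕ) {A : FockN d S.N →L[ℂ] FockN d S.N}
    (hA : IsDiag A (S.rho z i)) : IsBlockInverse (S.Q i) (S.HSub z) A := by
  rw [HSub_eq]
  refine isBlockInverse_mulP (β := fun _ => 0) (S.isDiag_Q i) (S.qInd_mul_self i) ?_ hA
    (S.qInd_mul_rho z i) fun n => ?_
  · rw [Q_WW_Q]
    exact isDiag_zero
  · rw [rho, add_zero, mul_assoc, inv_mul_cancel₀ (energy_sub_pos hz n).ne', mul_one]

theorem exists_isDiag_rho {z : ℝ} (hz : z < 0) (i : ℕ) :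
    ∃ A : FockN d S.N →L[ℂ] FockN d S.N, IsDiag A (S.rho z i) :=
  exists_isDiag _ (C := (-z)⁻¹) fun n => by
    rw [abs_of_nonneg (rho_nonneg hz i n)]
    exact rho_le hz i n

theorem blockInvertible_HSub {z : ℝ} (hz : z < 0) (i : ℕ) :
    BlockInvertible (S.Q i) (S.HSub z) := by
  obtain ⟨A, hA⟩ := S.exists_isDiag_rho hz i
  exact ⟨A, S.isBlockInverse_HSub hz i hA⟩

theorem isDiag_R {z : ℝ} (hz : z < 0) (i : ℕ) : IsDiag (S.R z i) (S.rho z i) := by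
  obtain ⟨A, hA⟩ := S.exists_isDiag_rho hz i
  rwa [R, (S.isBlockInverse_HSub hz i hA).blockInv_eq (S.Q_mul_self i)]

theorem isDiag_Rsqrt {z : ℝ} (hz : z < 0) (i : ℕ) :
    IsDiag (S.Rsqrt z i) (fun n => Real.sqrt (S.rho z i n)) :=
  (S.isDiag_R hz i).opSqrt (rho_nonneg hz i) (rho_le hz i)

/-- The diagonal of `Γ_{i,i}(z)`, `i = 2 s`. -/
def gam (z : ℝ) : ℕ → Config d S.N → ℝ
  | 0, _ => 0
  | s + 1, n => S.qInd (2 * s + 2) n * (S.coefW n ^ 2 *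
      (S.rho z (2 * s) (S.up n) * (1 - gam z s (S.up n) * S.rho z (2 * s) (S.up n))⁻¹))

/-- The resummed propagator `R_{i,i} ∑_l (Γ_{i,i} R_{i,i})^l`, `i = 2 s`. -/
def resummed (z : ℝ) (s : ℕ) : FockN d S.N →L[ℂ] FockN d S.N :=
  S.R z (2 * s) * ∑' l : ℕ, (S.Gam z s * S.R z (2 * s)) ^ l

/-- The value `Gam z 0 = 0` turns the Neumann sum into `0 ^ 0 = 1`, so the first step fits the
general formula. -/
theorem resummed_zero (z : ℝ) : S.resummed z 0 = S.R z 0 := by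
  have h : ∑' l : ℕ, (0 : FockN d S.N →L[ℂ] FockN d S.N) ^ l = 1 := by
    rw [tsum_eq_single 0 fun l hl => zero_pow hl, pow_zero]
  simp only [resummed, Gam, zero_mul, h, mul_one, mul_zero]

theorem Gam_succ (z : ℝ) (s : ℕ) :
    S.Gam z (s + 1) = S.Q (2 * s + 2) * S.W * S.Q (2 * s) * S.resummed z s *
      (S.Q (2 * s) * S.Wstar * S.Q (2 * s + 2)) := by
  cases s with
  | zero =>
    simp only [S.resummed_zero, Gam, Wblock, Wstarblock, mul_zero, zero_add]
  | succ s =>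
    simp only [Gam, resummed, Wblock, Wstarblock, mul_assoc]
    rfl

theorem sandwich_HSub (z : ℝ) (s : ℕ) :
    sandwich (S.QGt (2 * s)) (S.HSub z) = mulP (fun n => S.pInd (2 * s) n * (S.energy n - z))
      (S.QGt (2 * s) * (S.W + S.Wstar) * S.QGt (2 * s)) := by
  rw [HSub_eq, sandwich_mulP (S.isDiag_QGt _) (S.pInd_mul_self _)]

/-! ### The Feshbach–Schur flow reduced to a continued fraction. -/

/-- The scalar inequalities which control the continued fraction. -/
structure FlowBound (z : ℝ) (X : ℕ → ℝ) : Prop where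
  neg : z < 0
  zero : X 0 = 1
  pos : ∀ s, 2 * s + 2 ≤ S.N → 0 < X s
  step : ∀ s n, 2 * (s + 1) + 2 ≤ S.N →
    S.coefW n ^ 2 * S.rho z (2 * s) (S.up n) * S.rho z (2 * s + 2) n ≤ (1 - X (s + 1)) * X s

namespace FlowBound

variable {S} {z : ℝ} {X : ℕ → ℝ} (hX : S.FlowBound z X)

include hX

/-- The new quantity is `c / (1 - t)` with `c ≤ (1 - X (s+1)) * X s` by `step` and `X s ≤ 1 - t` by
induction; the factor `X s` cancels. -/
theorem gam_mem (s : ℕ) (hs : 2 * s + 2 ≤ S.N) (n : Config d S.N) :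
    0 ≤ S.gam z s n * S.rho z (2 * s) n ∧ S.gam z s n * S.rho z (2 * s) n ≤ 1 - X s := by
  induction s generalizing n with
  | zero => simp [gam, hX.zero]
  | succ s ih =>
    have h1 := ih (by omega) (S.up n)
    have h2 := hX.pos s (by omega)
    have h3 := hX.step s n hs
    have hρ := rho_nonneg hX.neg (2 * s) (S.up n)
    have hρ' := rho_nonneg hX.neg (2 * s + 2) n
    have e : S.gam z (s + 1) n * S.rho z (2 * (s + 1)) n =
        (S.coefW n ^ 2 * S.rho z (2 * s) (S.up n) * S.rho z (2 * s + 2) n) *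
          (1 - S.gam z s (S.up n) * S.rho z (2 * s) (S.up n))⁻¹ := by
      rw [gam, show 2 * (s + 1) = 2 * s + 2 by ring]
      conv_rhs => rw [← S.qInd_mul_rho z (2 * s + 2) n]
      ring
    have h4 : X s ≤ 1 - S.gam z s (S.up n) * S.rho z (2 * s) (S.up n) := by linarith [h1.2]
    have h5 : 0 < 1 - S.gam z s (S.up n) * S.rho z (2 * s) (S.up n) := h2.trans_le h4
    have h6 : 0 ≤ S.coefW n ^ 2 * S.rho z (2 * s) (S.up n) * S.rho z (2 * s + 2) n := by
      positivity
    rw [e]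
    refine ⟨mul_nonneg h6 (inv_nonneg.2 h5.le), ?_⟩
    rw [← div_eq_mul_inv, div_le_iff₀ h5]
    have h7 : 0 ≤ 1 - X (s + 1) := nonneg_of_mul_nonneg_left (h6.trans h3) h2
    exact h3.trans (mul_le_mul_of_nonneg_left h4 h7)

theorem le_one (s : ℕ) (hs : 2 * s + 2 ≤ S.N) : X s ≤ 1 := by
  obtain ⟨n⟩ : Nonempty (Config d S.N) := ⟨⟨Finsupp.single 0 S.N, by simp⟩⟩
  have := hX.gam_mem s hs n
  linarith [this.1, this.2]

theorem abs_le (s : ℕ) (hs : 2 * s + 2 ≤ S.N) (n : Config d S.N) :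
    |S.gam z s n * S.rho z (2 * s) n| ≤ 1 - X s := by
  rw [abs_of_nonneg (hX.gam_mem s hs n).1]
  exact (hX.gam_mem s hs n).2

theorem one_sub_ne_zero (s : ℕ) (hs : 2 * s + 2 ≤ S.N) (n : Config d S.N) :
    1 - S.gam z s n * S.rho z (2 * s) n ≠ 0 := by
  have h1 := (hX.gam_mem s hs n).2
  have h2 := hX.pos s hs
  linarith

theorem isDiag_tsum (s : ℕ) (hs : 2 * s + 2 ≤ S.N) (hΓ : IsDiag (S.Gam z s) (S.gam z s)) :
    IsDiag (∑' l : ℕ, (S.Gam z s * S.R z (2 * s)) ^ l)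
      (fun n => (1 - S.gam z s n * S.rho z (2 * s) n)⁻¹) :=
  (hΓ.mul (S.isDiag_R hX.neg (2 * s))).tsum_pow (by linarith [hX.le_one s hs])
    (by linarith [hX.pos s hs]) (hX.abs_le s hs)

theorem isDiag_resummed' (s : ℕ) (hs : 2 * s + 2 ≤ S.N) (hΓ : IsDiag (S.Gam z s) (S.gam z s)) :
    IsDiag (S.resummed z s)
      (fun n => S.rho z (2 * s) n * (1 - S.gam z s n * S.rho z (2 * s) n)⁻¹) :=
  (S.isDiag_R hX.neg (2 * s)).mul (hX.isDiag_tsum s hs hΓ)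

/-- A diagonal propagator between `W` and `W*` stays diagonal. Only the Neumann sum of the previous
index enters, so `2 * s ≤ N` suffices. -/
theorem isDiag_Gam (s : ℕ) (hs : 2 * s ≤ S.N) : IsDiag (S.Gam z s) (S.gam z s) := by
  induction s with
  | zero => exact isDiag_zero
  | succ s ih =>
    have h1 := hX.isDiag_resummed' s (by omega) (ih (by omega))
    have hq := S.isDiag_Q (2 * s)
    have hq' := S.isDiag_Q (2 * s + 2)
    have h2 := (hq'.mul (S.isDiag_conj_W ((hq.mul h1).mul hq))).mul hq'
    have e : S.Gam z (s + 1) = S.Q (2 * s + 2) *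
        (S.W * (S.Q (2 * s) * S.resummed z s * S.Q (2 * s)) * S.Wstar) * S.Q (2 * s + 2) := by
      rw [Gam_succ]
      simp only [mul_assoc]
    rw [e]
    refine h2.congr fun n => ?_
    rw [gam]
    have e1 := S.qInd_mul_self (2 * s + 2) n
    have e2 := S.qInd_mul_rho z (2 * s) (S.up n)
    generalize S.rho z (2 * s) (S.up n) = a at *
    generalize (1 - S.gam z s (S.up n) * a)⁻¹ = b
    calc S.qInd (2 * s + 2) n * (S.coefW n ^ 2 * (S.qInd (2 * s) (S.up n) * (a * b) *
        S.qInd (2 * s) (S.up n))) * S.qInd (2 * s + 2) n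
        = (S.qInd (2 * s + 2) n * S.qInd (2 * s + 2) n) * (S.coefW n ^ 2 *
          ((S.qInd (2 * s) (S.up n) * (S.qInd (2 * s) (S.up n) * a)) * b)) := by ring
      _ = _ := by rw [e1, e2, e2]

theorem isDiag_resummed (s : ℕ) (hs : 2 * s + 2 ≤ S.N) :
    IsDiag (S.resummed z s)
      (fun n => S.rho z (2 * s) n * (1 - S.gam z s n * S.rho z (2 * s) n)⁻¹) :=
  hX.isDiag_resummed' s hs (hX.isDiag_Gam s (by omega))

/-- Although sandwiched by the whole of `Q^{(>i+1)}`, the correction lives on `Q^{(i+2,i+3)}`, where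
it is the next effective interaction. This closes the induction in `flow`. -/
theorem isDiag_effective (s : ℕ) (hs : 2 * s + 2 ≤ S.N) :
    IsDiag (S.QGt (2 * s) * S.W * S.resummed z s * S.Wstar * S.QGt (2 * s)) (S.gam z (s + 1)) := by
  have hp := S.isDiag_QGt (2 * s)
  have h2 := (hp.mul (S.isDiag_conj_W (hX.isDiag_resummed s hs))).mul hp
  have e : S.QGt (2 * s) * S.W * S.resummed z s * S.Wstar * S.QGt (2 * s) =
      S.QGt (2 * s) * (S.W * S.resummed z s * S.Wstar) * S.QGt (2 * s) := by
    simp only [mul_assoc]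
  rw [e]
  refine h2.congr fun n => ?_
  rw [gam]
  by_cases h : 2 ≤ n.1 0
  · have e1 := S.pInd_mul_self (2 * s) n
    have e2 := S.qInd_mul_rho z (2 * s) (S.up n)
    have e3 := S.pInd_mul_qInd_up (2 * s) h
    generalize (1 - S.gam z s (S.up n) * S.rho z (2 * s) (S.up n))⁻¹ = b
    generalize S.rho z (2 * s) (S.up n) = a at *
    calc S.pInd (2 * s) n * (S.coefW n ^ 2 * (a * b)) * S.pInd (2 * s) n
        = (S.pInd (2 * s) n * S.pInd (2 * s) n) * (S.coefW n ^ 2 * (a * b)) := by ring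
      _ = (S.pInd (2 * s) n * S.qInd (2 * s) (S.up n)) * (S.coefW n ^ 2 * (a * b)) := by
          rw [e1]
          conv_lhs => rw [← e2]
          ring
      _ = S.qInd (2 * s + 2) n * (S.coefW n ^ 2 * ((S.qInd (2 * s) (S.up n) * a) * b)) := by
          rw [e3]; ring
      _ = _ := by rw [e2]
  · rw [S.coefW_eq_zero h]
    simp

/-- One Feshbach–Schur step, for an operator whose blocks are those of `H - z` up to the effective
interaction. -/
theorem feshbach_step (s : ℕ) (hs : 2 * s + 2 ≤ S.N) {f : Config d S.N → ℝ}
    {B : FockN d S.N →L[ℂ] FockN d S.N} (hK : S.KPrev z s = mulP f B)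
    (hfq : ∀ n, S.qInd (2 * s) n * f n = S.qInd (2 * s) n * (S.energy n - z))
    (hfp : ∀ n, S.pInd (2 * s) n * f n = S.pInd (2 * s) n * (S.energy n - z))
    (hQQ : IsDiag (S.Q (2 * s) * B * S.Q (2 * s)) (fun n => -S.gam z s n))
    (hPP : S.QGt (2 * s) * B * S.QGt (2 * s) =
      S.QGt (2 * s) * (S.W + S.Wstar) * S.QGt (2 * s))
    (hPQ : S.QGt (2 * s) * B * S.Q (2 * s) = S.QGt (2 * s) * S.W * S.Q (2 * s))
    (hQP : S.Q (2 * s) * B * S.QGt (2 * s) = S.Q (2 * s) * S.Wstar * S.QGt (2 * s)) :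
    BlockInvertible (S.Q (2 * s)) (S.KPrev z s) ∧
    S.K z s = mulP (fun n => S.pInd (2 * s) n * (S.energy n - z))
      (S.QGt (2 * s) * (S.W + S.Wstar) * S.QGt (2 * s) -
        S.QGt (2 * s) * S.W * S.resummed z s * S.Wstar * S.QGt (2 * s)) := by
  have hR := hX.isDiag_resummed s hs
  have hqρ : ∀ n, S.qInd (2 * s) n * (S.rho z (2 * s) n *
      (1 - S.gam z s n * S.rho z (2 * s) n)⁻¹) =
      S.rho z (2 * s) n * (1 - S.gam z s n * S.rho z (2 * s) n)⁻¹ := fun n => by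
    rw [← mul_assoc, qInd_mul_rho]
  -- The block to invert is `f - gam`. On the range of `Q`, `f` is `1 / rho`, so the reciprocal is
  -- `rho / (1 - gam * rho)`: the resummed propagator.
  have hβ : ∀ n, S.rho z (2 * s) n * (1 - S.gam z s n * S.rho z (2 * s) n)⁻¹ *
      (f n + -S.gam z s n) = S.qInd (2 * s) n := fun n => by
    have h1 := hX.one_sub_ne_zero s hs n
    have h2 := (energy_sub_pos (S := S) hX.neg n).ne'
    have h3 : S.rho z (2 * s) n * f n = S.qInd (2 * s) n := by
      rw [rho, mul_right_comm, hfq, mul_assoc, mul_inv_cancel₀ h2, mul_one]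
    have h4 := S.qInd_mul_rho z (2 * s) n
    have h5 : S.rho z (2 * s) n * (f n + -S.gam z s n) =
        S.qInd (2 * s) n * (1 - S.gam z s n * S.rho z (2 * s) n) := by
      linear_combination h3 + S.gam z s n * h4
    rw [mul_right_comm, h5, mul_assoc, mul_inv_cancel₀ h1, mul_one]
  constructor
  · rw [hK]
    exact ⟨_, isBlockInverse_mulP (S.isDiag_Q _) (S.qInd_mul_self _) hQQ hR hqρ hβ⟩
  · have hQR : S.Q (2 * s) * S.resummed z s = S.resummed z s :=
      (((S.isDiag_Q _).mul hR).congr hqρ).eq hR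
    have hRQ : S.resummed z s * S.Q (2 * s) = S.resummed z s :=
      ((hR.mul (S.isDiag_Q _)).congr fun n => by rw [mul_comm, hqρ]).eq hR
    rw [K, hK, feshbach_mulP (S.isDiag_QGt _) (S.pInd_mul_self _) (S.isDiag_Q _)
      (S.qInd_mul_self _) (S.pInd_mul_qInd _) hQQ hR hqρ hβ]
    congr 1
    · exact funext hfp
    · rw [hPP]
      congr 1
      have e : ∀ A C : FockN d S.N →L[ℂ] FockN d S.N,
          S.QGt (2 * s) * A * S.resummed z s * C * S.QGt (2 * s) =
          (S.QGt (2 * s) * A * S.Q (2 * s)) * S.resummed z s *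
            (S.Q (2 * s) * C * S.QGt (2 * s)) := by
        intro A C
        conv_lhs => rw [← hQR, ← hRQ]
        simp only [mul_assoc]
      rw [e, e, hPQ, hQP]

/-- The correction `D` of the previous step is diagonal and supported on the block now being
eliminated. It shifts the diagonal there by `-gam` and is absent from the other blocks, where `W`
and `W*` are still the original ones. -/
theorem flow (s : ℕ) (hs : 2 * s + 2 ≤ S.N) :
    BlockInvertible (S.Q (2 * s)) (S.KPrev z s) ∧
    S.K z s = mulP (fun n => S.pInd (2 * s) n * (S.energy n - z))
      (S.QGt (2 * s) * (S.W + S.Wstar) * S.QGt (2 * s) -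
        S.QGt (2 * s) * S.W * S.resummed z s * S.Wstar * S.QGt (2 * s)) := by
  induction s with
  | zero =>
    refine hX.feshbach_step 0 hs (S.HSub_eq z) (fun _ => rfl) (fun _ => rfl) ?_ rfl
      (S.QGt_WW_Q _) (S.Q_WW_QGt _)
    rw [Q_WW_Q]
    exact isDiag_zero.congr fun n => by simp [gam]
  | succ s ih =>
    obtain ⟨-, hK⟩ := ih (by omega)
    have hD := hX.isDiag_effective s (by omega)
    have e2 : 2 * (s + 1) = 2 * s + 2 := by ring
    have hq := S.isDiag_Q (2 * s + 2)
    have hp := S.isDiag_QGt (2 * s + 2)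
    have hqg : ∀ n, S.qInd (2 * s + 2) n * S.gam z (s + 1) n = S.gam z (s + 1) n := fun n => by
      rw [gam, ← mul_assoc, qInd_mul_self]
    have hpg : ∀ n, S.pInd (2 * s + 2) n * S.gam z (s + 1) n = 0 := fun n => by
      rw [← hqg, ← mul_assoc, pInd_mul_qInd, zero_mul]
    set D := S.QGt (2 * s) * S.W * S.resummed z s * S.Wstar * S.QGt (2 * s)
    have hPD : S.QGt (2 * s + 2) * D = 0 := ((hp.mul hD).congr hpg).eq isDiag_zero
    have hDP : D * S.QGt (2 * s + 2) = 0 :=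
      ((hD.mul hp).congr fun n => by rw [mul_comm, hpg]).eq isDiag_zero
    -- Blocks within `Q^{(>i+1)}` absorb the outer projections left by the previous step.
    have split : ∀ A C : FockN d S.N →L[ℂ] FockN d S.N, A * S.QGt (2 * s) = A →
        S.QGt (2 * s) * C = C →
        A * (S.QGt (2 * s) * (S.W + S.Wstar) * S.QGt (2 * s) - D) * C =
          A * (S.W + S.Wstar) * C - A * D * C := by
      intro A C hA hC
      rw [mul_sub, sub_mul, ← mul_assoc, ← mul_assoc, hA, mul_assoc _ _ C, hC]
    refine hX.feshbach_step (s + 1) hs hK (fun n => ?_) (fun n => ?_) ?_ ?_ ?_ ?_ <;> rw [e2]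
    · rw [← mul_assoc, qInd_mul_pInd_add_two]
    · rw [← mul_assoc, pInd_mul_pInd_add_two]
    · rw [split _ _ (S.Q_mul_QGt _) (S.QGt_mul_Q _), Q_WW_Q]
      refine (isDiag_zero.sub ((hq.mul hD).mul hq)).congr fun n => ?_
      rw [hqg, mul_comm, hqg, zero_sub]
    · rw [split _ _ (S.QGt_mul_QGt _) (S.QGt_mul_QGt' _), hPD, zero_mul, sub_zero]
    · rw [split _ _ (S.QGt_mul_QGt _) (S.QGt_mul_Q _), hPD, zero_mul, sub_zero, QGt_WW_Q]
    · rw [split _ _ (S.Q_mul_QGt _) (S.QGt_mul_QGt' _), mul_assoc _ D, hDP, mul_zero, sub_zero,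
        Q_WW_QGt]

theorem K_eq (s : ℕ) (hs : 2 * s + 2 ≤ S.N) :
    S.K z s = sandwich (S.QGt (2 * s)) (S.HSub z) -
      toP (S.QGt (2 * s) * S.W * S.resummed z s * S.Wstar * S.QGt (2 * s)) := by
  rw [S.sandwich_HSub, mulP_sub_toP, (hX.flow s hs).2]

theorem K_domain (s : ℕ) (hs : 2 * s + 2 ≤ S.N) :
    (S.K z s).domain = (sandwich (S.QGt (2 * s)) (S.HSub z)).domain := by
  rw [S.sandwich_HSub, (hX.flow s hs).2]
  rfl

theorem K_selfAdjoint (s : ℕ) (hs : 2 * s + 2 ≤ S.N) : IsSelfAdjoint (S.K z s) := by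
  rw [(hX.flow s hs).2]
  refine isSelfAdjoint_mulP _ (IsSelfAdjoint.sub ?_ (hX.isDiag_effective s hs).isSelfAdjoint)
  have hp := (S.isDiag_QGt (2 * s)).isSelfAdjoint
  rw [IsSelfAdjoint, star_mul, star_mul, star_add, S.adjoint_W, S.adjoint_Wstar, hp.star_eq,
    mul_assoc, add_comm S.Wstar]

theorem isDiag_GamSym (s : ℕ) (hs : 2 * s + 2 ≤ S.N) :
    IsDiag (S.GamSym z s) (fun n => S.gam z s n * S.rho z (2 * s) n) := by
  have h := S.isDiag_Rsqrt hX.neg (2 * s)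
  refine ((h.mul (hX.isDiag_Gam s (by omega))).mul h).congr fun n => ?_
  rw [mul_right_comm, Real.mul_self_sqrt (rho_nonneg hX.neg _ n), mul_comm]

theorem isDiag_tsum_GamSym (s : ℕ) (hs : 2 * s + 2 ≤ S.N) :
    IsDiag (∑' l : ℕ, (S.GamSym z s) ^ l) (fun n => (1 - S.gam z s n * S.rho z (2 * s) n)⁻¹) :=
  (hX.isDiag_GamSym s hs).tsum_pow (by linarith [hX.le_one s hs])
    (by linarith [hX.pos s hs]) (hX.abs_le s hs)

theorem summable_Gam (s : ℕ) (hs : 2 * s + 2 ≤ S.N) :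
    Summable (fun l : ℕ => (S.Gam z s * S.R z (2 * s)) ^ l) :=
  ((hX.isDiag_Gam s (by omega)).mul (S.isDiag_R hX.neg (2 * s))).summable_pow
    (by linarith [hX.le_one s hs]) (by linarith [hX.pos s hs]) (hX.abs_le s hs)

theorem summable_GamSym (s : ℕ) (hs : 2 * s + 2 ≤ S.N) :
    Summable (fun l : ℕ => (S.GamSym z s) ^ l) :=
  (hX.isDiag_GamSym s hs).summable_pow
    (by linarith [hX.le_one s hs]) (by linarith [hX.pos s hs]) (hX.abs_le s hs)

theorem resummed_eq (s : ℕ) (hs : 2 * s + 2 ≤ S.N) :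
    S.resummed z s =
      S.Rsqrt z (2 * s) * (∑' l : ℕ, (S.GamSym z s) ^ l) * S.Rsqrt z (2 * s) := by
  have h := S.isDiag_Rsqrt hX.neg (2 * s)
  refine (hX.isDiag_resummed s hs).eq
    (((h.mul (hX.isDiag_tsum_GamSym s hs)).mul h).congr fun n => ?_)
  rw [mul_right_comm, Real.mul_self_sqrt (rho_nonneg hX.neg _ n)]

theorem Gam_eq_symmetric (s : ℕ) (hs2 : 2 ≤ s) (hs : 2 * s + 2 ≤ S.N) :
    S.Gam z s = S.Wblock (2 * s) (2 * (s - 1)) * S.Rsqrt z (2 * (s - 1)) *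
      (∑' l : ℕ, (S.GamSym z (s - 1)) ^ l) *
      S.Rsqrt z (2 * (s - 1)) * S.Wstarblock (2 * (s - 1)) (2 * s) := by
  obtain ⟨t, rfl⟩ : ∃ t, s = t + 1 := ⟨s - 1, by omega⟩
  rw [Gam_succ, Nat.add_sub_cancel, hX.resummed_eq t (by omega)]
  simp only [Wblock, Wstarblock, mul_assoc, mul_add, mul_one]

theorem norm_GamCheck_le (s : ℕ) (hs : 2 * s + 2 ≤ S.N) : ‖S.GamCheck z s‖ ≤ 1 / X s := by
  have h : IsDiag (S.GamCheck z s) (fun n => (1 - S.gam z s n * S.rho z (2 * s) n)⁻¹) := by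
    cases s with
    | zero => exact isDiag_one.congr fun n => by simp [gam]
    | succ s => exact hX.isDiag_tsum_GamSym (s + 1) hs
  have h1 := hX.pos s hs
  refine h.norm_le (by positivity) fun n => ?_
  have h2 : X s ≤ 1 - S.gam z s n * S.rho z (2 * s) n := by
    linarith [(hX.gam_mem s hs n).2]
  rw [abs_of_nonneg (inv_nonneg.2 (h1.le.trans h2)), one_div]
  exact inv_anti₀ h1 h2

end FlowBound

end ThreeModes

/-! ## The auxiliary sequence -/

theorem chi_one_add_sqrt {ε : ℝ} (hε : ε < 1) : chi (1 + Real.sqrt ε) = 1 := by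
  have h1 : Real.sqrt ε < 1 := by
    rw [Real.sqrt_lt' one_pos]
    simpa using hε
  have h2 := Real.sqrt_nonneg ε
  have h3 : 1 + Real.sqrt ε ∈ Set.Ico (0 : ℝ) 2 := ⟨by linarith, by linarith⟩
  rw [chi, Set.indicator_of_mem h3]
  rfl

/-- The quantity `δ √(ε² + 2ε)` with `δ = 1 + √ε`. -/
def shift (ε : ℝ) : ℝ := (1 + Real.sqrt ε) * Real.sqrt (ε ^ 2 + 2 * ε)

theorem bSeq_eq {ε : ℝ} (hε : ε < 1) : bSeq ε = (1 + ε) * shift ε := by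
  rw [bSeq, chi_one_add_sqrt hε, shift]
  ring

theorem one_sub_cSeq {ε : ℝ} (h0 : 0 ≤ ε) (hε : ε < 1) :
    1 - cSeq ε = (1 + ε) ^ 2 - shift ε ^ 2 := by
  rw [cSeq, chi_one_add_sqrt hε, shift, mul_pow, Real.sq_sqrt (by positivity)]
  ring

theorem sqrt_le_of_le {ε : ℝ} (hε : ε ≤ 1 / 10 ^ 8) : Real.sqrt ε ≤ 1 / 10 ^ 4 := by
  rw [Real.sqrt_le_left (by norm_num)]
  linarith

/-- The constants bracket √2; the factor `1 + √ε` costs at most `10⁻⁴` relatively. -/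
theorem shift_bounds {ε : ℝ} (h0 : 0 < ε) (hε : ε ≤ 1 / 10 ^ 8) :
    141 / 100 * Real.sqrt ε ≤ shift ε ∧ shift ε ≤ 142 / 100 * Real.sqrt ε := by
  have hw := Real.sqrt_pos.2 h0
  have hw' := sqrt_le_of_le hε
  have hs : ε = Real.sqrt ε ^ 2 := (Real.sq_sqrt h0.le).symm
  rw [shift]
  set w := Real.sqrt ε
  rw [hs]
  constructor
  · have h1 : 141 / 100 * w ≤ Real.sqrt ((w ^ 2) ^ 2 + 2 * w ^ 2) := by
      apply Real.le_sqrt_of_sq_le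
      nlinarith [sq_nonneg (w ^ 2)]
    nlinarith
  · have h1 : Real.sqrt ((w ^ 2) ^ 2 + 2 * w ^ 2) ≤ 1415 / 1000 * w := by
      rw [Real.sqrt_le_left (by positivity)]
      nlinarith [sq_nonneg (w ^ 2), mul_pos hw hw, mul_nonneg (mul_pos hw hw).le hw.le]
    calc (1 + w) * Real.sqrt ((w ^ 2) ^ 2 + 2 * w ^ 2) ≤ (1 + w) * (1415 / 1000 * w) := by
          gcongr
      _ ≤ _ := by nlinarith

/-- The denominator `1 + a_ε - 2 b_ε / M - (1 - c_ε) / M²` for `a_ε = 2 ε`. -/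
def denom (ε M : ℝ) : ℝ := 1 + 2 * ε - 2 * bSeq ε / M - (1 - cSeq ε) / M ^ 2

theorem XSeq_succ (ε : ℝ) (N s : ℕ) : XSeq (2 * ε) ε N (s + 1) =
    1 - 1 / (4 * denom ε ((N : ℝ) - 2 * s - 1) * XSeq (2 * ε) ε N s) := rfl

/-- Comparison of the two resummations `P / (1 - P)`, `P = (2 b M + 1) / M²`, and
`(1 - e + 2 b y) / (y² - 1)`, `y = M - q`. -/
theorem resummation_le {b q e M : ℝ} (hq0 : 0 < q) (hq : q ≤ 1 / 100) (hb0 : 0 < b)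
    (hb : b ≤ 2 * q ^ 2) (he : e ≤ b * q) (hM : 3 ≤ M) :
    (1 + 2 * b * M) * ((M - q) ^ 2 - 1) ≤
      (1 - e + 2 * b * (M - q)) * (M ^ 2 - 1 - 2 * b * M) := by
  have hbq : b ≤ q / 50 := by nlinarith
  -- The right side is `(M² - 1 - 2bM) - (y² - 1)` with `y = M - q`: the gain from the shift `q`,
  -- which dominates because `b` is much smaller than `q`.
  have h1 : 3 / 2 * q * M ≤ 2 * q * M - q ^ 2 - 2 * b * M := by nlinarith
  have h2 : 0 ≤ 1 + 2 * b * M := by positivity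
  have h3 : 0 ≤ M ^ 2 - 1 - 2 * b * M := by nlinarith
  -- The loss: the two numerators differ by `e + 2bq`.
  have h4 : (e + 2 * b * q) * (M ^ 2 - 1 - 2 * b * M) ≤ 3 * b * q * M ^ 2 := by
    calc (e + 2 * b * q) * (M ^ 2 - 1 - 2 * b * M)
        ≤ (3 * b * q) * (M ^ 2 - 1 - 2 * b * M) :=
          mul_le_mul_of_nonneg_right (by linarith) h3
      _ ≤ (3 * b * q) * M ^ 2 := by
          apply mul_le_mul_of_nonneg_left _ (by positivity)
          nlinarith
      _ = _ := by ring
  have h5 : 3 * b * q * M ^ 2 ≤ (1 + 2 * b * M) * (2 * q * M - q ^ 2 - 2 * b * M) := by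
    calc 3 * b * q * M ^ 2 ≤ (1 + 2 * b * M) * (3 / 2 * q * M) := by
          have : 0 ≤ q * M := by positivity
          nlinarith
      _ ≤ _ := mul_le_mul_of_nonneg_left h1 h2
  nlinarith

/-! ### The subsolution and the lower bound for the auxiliary sequence. -/

section Parameters

variable {ε : ℝ} (h0 : 0 < ε) (hε : ε ≤ 1 / 10 ^ 8)

include h0 hε

theorem bSeq_bounds : 141 / 100 * Real.sqrt ε ≤ bSeq ε ∧ bSeq ε ≤ 143 / 100 * Real.sqrt ε := by
  obtain ⟨h1, h2⟩ := shift_bounds h0 hε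
  have hw := Real.sqrt_pos.2 h0
  rw [bSeq_eq (by linarith)]
  constructor <;> nlinarith

theorem one_sub_cSeq_bounds : 0 ≤ 1 - cSeq ε ∧ 1 - cSeq ε ≤ 1 := by
  obtain ⟨h1, h2⟩ := shift_bounds h0 hε
  have hw := Real.sqrt_pos.2 h0
  have hw' := sqrt_le_of_le hε
  have h3 : cSeq ε = ((1 + Real.sqrt ε) ^ 2 - 1) * (ε ^ 2 + 2 * ε) := by
    rw [cSeq, chi_one_add_sqrt (by linarith)]
    ring
  constructor
  · rw [one_sub_cSeq h0.le (by linarith)]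
    nlinarith
  · rw [h3]
    have : 0 ≤ ((1 + Real.sqrt ε) ^ 2 - 1) * (ε ^ 2 + 2 * ε) :=
      mul_nonneg (by nlinarith) (by positivity)
    linarith

/-- This is `σ² (1 + 2ε) ≤ 2ε` cleared of denominators, the condition on the subsolution as `M → ∞`.
To leading order `b²` is `2ε(1 + √ε)²`; taking `τ = 1 + 2√ε` leaves room for the corrections. -/
theorem bSeq_sq_le : bSeq ε ^ 2 * (1 + 2 * ε) ≤ 2 * ε * (1 + 2 * Real.sqrt ε) ^ 2 := by
  have hw := Real.sqrt_pos.2 h0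
  have hw' := sqrt_le_of_le hε
  have hs : ε = Real.sqrt ε ^ 2 := (Real.sq_sqrt h0.le).symm
  have h1 : bSeq ε ^ 2 = (1 + ε) ^ 2 * (1 + Real.sqrt ε) ^ 2 * (ε ^ 2 + 2 * ε) := by
    rw [bSeq_eq (by linarith), shift, mul_pow, mul_pow, Real.sq_sqrt (by positivity)]
    ring
  rw [h1]
  set w := Real.sqrt ε
  have h2 : (1 + ε) ^ 2 * (1 + ε / 2) * (1 + 2 * ε) ≤ 1 + w := by
    have e1 : (1 + ε) ^ 2 ≤ 1 + 3 * ε := by nlinarith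
    have e2 : (1 + ε / 2) * (1 + 2 * ε) ≤ 1 + 3 * ε := by nlinarith
    calc (1 + ε) ^ 2 * (1 + ε / 2) * (1 + 2 * ε) = (1 + ε) ^ 2 * ((1 + ε / 2) * (1 + 2 * ε)) := by
          ring
      _ ≤ (1 + 3 * ε) * (1 + 3 * ε) := by gcongr
      _ ≤ 1 + w := by nlinarith
  have h3 : (1 + w) * (1 + w) ^ 2 ≤ (1 + 2 * w) ^ 2 := by nlinarith
  calc (1 + ε) ^ 2 * (1 + w) ^ 2 * (ε ^ 2 + 2 * ε) * (1 + 2 * ε)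
      = 2 * ε * (((1 + ε) ^ 2 * (1 + ε / 2) * (1 + 2 * ε)) * (1 + w) ^ 2) := by ring
    _ ≤ 2 * ε * ((1 + w) * (1 + w) ^ 2) := by gcongr
    _ ≤ _ := by gcongr

theorem sqrt_sqrt_bounds : 0 < Real.sqrt (Real.sqrt ε) ∧ Real.sqrt (Real.sqrt ε) ≤ 1 / 100 ∧
    Real.sqrt (Real.sqrt ε) ^ 2 = Real.sqrt ε := by
  have hw := Real.sqrt_pos.2 h0
  have hw' := sqrt_le_of_le hε
  refine ⟨Real.sqrt_pos.2 hw, ?_, Real.sq_sqrt hw.le⟩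
  rw [Real.sqrt_le_left (by norm_num)]
  linarith

/-- The comparison sequence is a subsolution of the recursion. -/
theorem subsolution_step {M σ τ q : ℝ} (hM : 3 ≤ M) (hq : q = Real.sqrt (Real.sqrt ε))
    (hτ : τ = 1 + 2 * Real.sqrt ε) (hσ : σ = bSeq ε / τ) :
    0 < denom ε M ∧ 0 < 1 + (σ - τ / (M + 1 - q)) ∧
      1 ≤ denom ε M * (1 + (σ - τ / (M + 1 - q))) * (1 - (σ - τ / (M - 1 - q))) := by
  obtain ⟨hq0, hq1, hqw⟩ := sqrt_sqrt_bounds h0 hε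
  rw [← hq] at hq0 hq1 hqw
  have hw := Real.sqrt_pos.2 h0
  have hw' := sqrt_le_of_le hε
  obtain ⟨hb1, hb2⟩ := bSeq_bounds h0 hε
  obtain ⟨hc1, hc2⟩ := one_sub_cSeq_bounds h0 hε
  have hsq := bSeq_sq_le h0 hε
  have hs : ε = Real.sqrt ε ^ 2 := (Real.sq_sqrt h0.le).symm
  set w := Real.sqrt ε
  set b := bSeq ε with hb
  have hτ0 : 0 < τ := by rw [hτ]; positivity
  have hb0 : 0 < b := by linarith [mul_pos (by norm_num : (0 : ℝ) < 141 / 100) hw]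
  have hσ0 : 0 < σ := by rw [hσ]; positivity
  have hστ : σ * τ = b := by rw [hσ, div_mul_cancel₀ _ hτ0.ne']
  have hσ2 : σ ^ 2 * (1 + 2 * ε) ≤ 2 * ε := by
    have : σ ^ 2 * τ ^ 2 = b ^ 2 := by rw [← mul_pow, hστ]
    rw [← hτ, ← this] at hsq
    have h3 : 0 < τ ^ 2 := by positivity
    refine le_of_mul_le_mul_right ?_ h3
    linarith
  have hM0 : 0 < M := by linarith
  set P := (1 + 2 * b * M) / M ^ 2 with hP
  have hPpos : 0 < P := by positivity
  have hb1' : b ≤ 1 / 100 := by linarith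
  have hM3 : 3 * M ≤ M ^ 2 := by
    rw [sq]
    exact mul_le_mul_of_nonneg_right hM hM0.le
  have hD : 0 < M ^ 2 - 1 - 2 * b * M := by
    have := mul_le_mul_of_nonneg_right hb1' hM0.le
    linarith
  have hP1 : 1 - P = (M ^ 2 - 1 - 2 * b * M) / M ^ 2 := by
    rw [hP]; field_simp; ring
  have hP1' : 0 < 1 - P := by rw [hP1]; positivity
  have hA : 1 + 2 * ε - P ≤ denom ε M := by
    have h1 : (1 - cSeq ε) / M ^ 2 ≤ 1 / M ^ 2 := by gcongr
    have h2 : P = 2 * b / M + 1 / M ^ 2 := by rw [hP]; field_simp; ring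
    rw [denom, ← hb, h2]
    linarith
  have hy1 : 0 < M + 1 - q := by linarith
  have hy2 : 0 < M - 1 - q := by linarith
  have hY : 0 < (M - q) ^ 2 - 1 := by
    have h1 : (M - q) ^ 2 - 1 = (M + 1 - q) * (M - 1 - q) := by ring
    rw [h1]
    positivity
  set P' := (2 * τ - τ ^ 2 + 2 * b * (M - q)) / ((M - q) ^ 2 - 1) with hP'
  -- With `y = M - q` the shifts are `y ± 1`, and `σ τ = b` turns the cross terms into `2 b y`.
  have hG : (1 + (σ - τ / (M + 1 - q))) * (1 - (σ - τ / (M - 1 - q))) = 1 - σ ^ 2 + P' := by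
    have h1 : (M - q) ^ 2 - 1 = (M + 1 - q) * (M - 1 - q) := by ring
    rw [hP', h1, ← hστ]
    field_simp
    ring
  have hu : 0 < 1 + (σ - τ / (M + 1 - q)) := by
    have : τ / (M + 1 - q) < 1 := by
      rw [div_lt_one hy1, hτ]
      linarith
    linarith
  -- The defect `(τ - 1)² = 4w²` must be dominated by `b q`, of order `w^{3/2}`; the choice `q = √w`
  -- achieves this.
  have hwb : 4 * w ^ 2 ≤ b * q := by
    calc 4 * w ^ 2 = (4 * q * w) * q := by rw [← hqw]; ring
      _ ≤ b * q := by
        refine mul_le_mul_of_nonneg_right ?_ hq0.le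
        have := mul_le_mul_of_nonneg_right hq1 hw.le
        linarith
  have hres := resummation_le (e := 4 * w ^ 2) hq0 hq1 hb0 (by linarith) hwb hM
  have hτ2 : 2 * τ - τ ^ 2 = 1 - 4 * w ^ 2 := by rw [hτ]; ring
  have hP'0 : 0 ≤ P' := by
    rw [hP', hτ2]
    apply div_nonneg _ hY.le
    have : 0 ≤ 2 * b * (M - q) := mul_nonneg (by positivity) (by linarith)
    have h3 : w ^ 2 ≤ 1 / 4 := by
      rw [← hs]
      linarith
    linarith
  have hPP : 1 ≤ (1 - P) * (1 + P') := by
    have h1 : P ≤ P' * (1 - P) := by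
      rw [hP1, hP', hτ2, hP, div_mul_div_comm, div_le_div_iff₀ (by positivity) (by positivity)]
      calc (1 + 2 * b * M) * (((M - q) ^ 2 - 1) * M ^ 2)
          = ((1 + 2 * b * M) * ((M - q) ^ 2 - 1)) * M ^ 2 := by ring
        _ ≤ _ := mul_le_mul_of_nonneg_right hres (by positivity)
    linarith
  -- The product is `(1 - P)(1 + P') + 2ε - σ²(1 + 2ε)` plus the nonnegative terms `2εP'` and `Pσ²`.
  have hmain : 1 ≤ (1 + 2 * ε - P) * (1 - σ ^ 2 + P') := by
    have h1 : 0 ≤ ε * P' := by positivity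
    have h2 : 0 ≤ P * σ ^ 2 := by positivity
    calc 1 ≤ (1 - P) * (1 + P') + (2 * ε - σ ^ 2 * (1 + 2 * ε)) := by linarith
      _ ≤ _ := by linarith
  have hApos : 0 < denom ε M := by linarith
  refine ⟨hApos, hu, ?_⟩
  rw [mul_assoc, hG]
  have hGpos : 0 ≤ 1 - σ ^ 2 + P' := by
    have : 0 ≤ σ ^ 2 * (2 * ε) := by positivity
    linarith
  exact hmain.trans (mul_le_mul_of_nonneg_right hA hGpos)

theorem denom_pos {M : ℝ} (hM : 3 ≤ M) : 0 < denom ε M :=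
  (subsolution_step h0 hε hM rfl rfl rfl).1

/-- The map `X ↦ 1 - 1/(4 A X)` is increasing on `X > 0`, so a subsolution starting below `X 0 = 1`
stays below the sequence. -/
theorem le_XSeq {N s : ℕ} (hs : 2 * s + 2 ≤ N) :
    (1 + (bSeq ε / (1 + 2 * Real.sqrt ε) -
      (1 + 2 * Real.sqrt ε) / ((N : ℝ) - 2 * s - Real.sqrt (Real.sqrt ε)))) / 2 ≤
      XSeq (2 * ε) ε N s := by
  obtain ⟨hq0, hq1, hqw⟩ := sqrt_sqrt_bounds h0 hε
  have hw := Real.sqrt_pos.2 h0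
  have hw' := sqrt_le_of_le hε
  induction s with
  | zero =>
    have hN : (2 : ℝ) ≤ N := by exact_mod_cast hs
    have h1 : bSeq ε / (1 + 2 * Real.sqrt ε) ≤ 1 := by
      rw [div_le_one (by positivity)]
      linarith [(bSeq_bounds h0 hε).2]
    have h2 : 0 ≤ (1 + 2 * Real.sqrt ε) /
        ((N : ℝ) - 2 * (0 : ℕ) - Real.sqrt (Real.sqrt ε)) := by
      apply div_nonneg (by positivity)
      push_cast
      linarith
    rw [XSeq]
    linarith
  | succ s ih =>
    have ih := ih (by omega)
    have hN : (2 : ℝ) * s + 4 ≤ N := by exact_mod_cast (by omega : 2 * s + 4 ≤ N)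
    obtain ⟨hA, hu, h1⟩ := subsolution_step h0 hε (M := (N : ℝ) - 2 * s - 1) (by linarith)
      rfl rfl rfl
    rw [show (N : ℝ) - 2 * s - 1 + 1 = N - 2 * s by ring] at hu h1
    rw [show (N : ℝ) - 2 * s - 1 - 1 = N - 2 * (s + 1 : ℕ) by push_cast; ring] at h1
    rw [XSeq_succ]
    set A := denom ε ((N : ℝ) - 2 * s - 1)
    generalize 1 + (bSeq ε / (1 + 2 * Real.sqrt ε) -
      (1 + 2 * Real.sqrt ε) / ((N : ℝ) - 2 * s - Real.sqrt (Real.sqrt ε))) = v at *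
    generalize bSeq ε / (1 + 2 * Real.sqrt ε) - (1 + 2 * Real.sqrt ε) /
      ((N : ℝ) - 2 * (s + 1 : ℕ) - Real.sqrt (Real.sqrt ε)) = u' at *
    have hX : 0 < XSeq (2 * ε) ε N s := by linarith
    have h2 : 1 / (4 * A * XSeq (2 * ε) ε N s) ≤ (1 - u') / 2 := by
      rw [div_le_div_iff₀ (by positivity) two_pos]
      have hu' : 0 ≤ 1 - u' := by
        by_contra h
        have : A * v * (1 - u') < 0 := mul_neg_of_pos_of_neg (by positivity) (by linarith)
        linarith
      have : A * v * (1 - u') ≤ A * (2 * XSeq (2 * ε) ε N s) * (1 - u') := by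
        gcongr
        linarith
      linarith
    linarith

end Parameters

/-- The deviation of the lower bound for the auxiliary sequence from `1 / 4`. -/
def remainder (ε : ℝ) : ℝ :=
  (1 - (1 + 2 * Real.sqrt ε) / (2 - Real.sqrt (Real.sqrt ε))) / 2 - 1 / 4

theorem tendsto_remainder : Tendsto remainder (𝓝[>] 0) (𝓝 0) := by
  have h : ContinuousAt remainder 0 := by
    unfold remainder
    refine ContinuousAt.sub (ContinuousAt.div_const (continuousAt_const.sub
      (ContinuousAt.div (by fun_prop) (by fun_prop) (by simp))) _) continuousAt_const
  have h2 : remainder 0 = 0 := by norm_num [remainder]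
  have h3 := h.tendsto
  rw [h2] at h3
  exact h3.mono_left nhdsWithin_le_nhds

/-- The positive `σ` is dropped, and `N - 2s ≥ 2` gives the smallest denominator. -/
theorem remainder_le_XSeq {ε : ℝ} (h0 : 0 < ε) (hε : ε ≤ 1 / 10 ^ 8) {N s : ℕ}
    (hs : 2 * s + 2 ≤ N) : 1 / 4 + remainder ε ≤ XSeq (2 * ε) ε N s := by
  refine le_trans ?_ (le_XSeq h0 hε hs)
  obtain ⟨hq0, hq1, -⟩ := sqrt_sqrt_bounds h0 hε
  have hw := Real.sqrt_pos.2 h0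
  have hN : (2 : ℝ) * s + 2 ≤ N := by exact_mod_cast hs
  have h1 : 0 ≤ bSeq ε / (1 + 2 * Real.sqrt ε) := by
    apply div_nonneg _ (by positivity)
    linarith [(bSeq_bounds h0 hε).1]
  have h2 : (1 + 2 * Real.sqrt ε) / ((N : ℝ) - 2 * s - Real.sqrt (Real.sqrt ε)) ≤
      (1 + 2 * Real.sqrt ε) / (2 - Real.sqrt (Real.sqrt ε)) := by
    apply div_le_div_of_nonneg_left (by positivity) (by linarith)
    linarith
  rw [remainder]
  linarith

theorem XSeq_pos {ε : ℝ} (h0 : 0 < ε) (hε : ε ≤ 1 / 10 ^ 8) {N s : ℕ}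
    (hs : 2 * s + 2 ≤ N) : 0 < XSeq (2 * ε) ε N s := by
  refine lt_of_lt_of_le ?_ (remainder_le_XSeq h0 hε hs)
  obtain ⟨hq0, hq1, -⟩ := sqrt_sqrt_bounds h0 hε
  have hw' := sqrt_le_of_le hε
  have h2 : (1 + 2 * Real.sqrt ε) / (2 - Real.sqrt (Real.sqrt ε)) < 1 := by
    rw [div_lt_one (by linarith)]
    linarith
  rw [remainder]
  linarith

/-! ## The scalar estimate for one pair of neighbouring sectors -/

/-- Here `x` counts the zero mode and `m` the modes ±j. Up to `(φ/N)²` the right side bounds two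
neighbouring values of `energy - z` from below, and the factor `x (x - 1)` of `W` is to be split
off. The weight `N ≥ x` helps; the obstacle is `x - 2` in place of `x - 1`. -/
theorem sector_product_le {N x m e ζ : ℝ} (hx : 2 ≤ x) (hm : 1 ≤ m) (hN : x + m ≤ N)
    (he : 0 ≤ e) (hζ : 99 / 100 ≤ ζ) (hNe : 2 ≤ N * e) (hN20 : 20 ≤ N) :
    x * (x - 1) * ((m + (e * m + ζ)) * (m + 2 + (e * (m + 2) + ζ))) ≤
      (x * m + N * (e * m + ζ)) * ((x - 2) * (m + 2) + N * (e * (m + 2) + ζ)) := by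
  have he1 : 99 / 100 ≤ e * m + ζ := by nlinarith
  have he2 : 99 / 100 ≤ e * (m + 2) + ζ := by nlinarith
  have he2' : e * (m + 2) ≤ e * (m + 2) + ζ := by linarith
  set e₁ := e * m + ζ
  set e₂ := e * (m + 2) + ζ
  have hx1 : 0 ≤ x - 1 := by linarith
  -- In the first case half of `N e₂` pays for the missing `m + 2`, because `N e ≥ 2`, and the
  -- factors compare separately. In the second the last factor may fall short by `1 + m/50`, but `N
  -- ≥ x + m` gives the other a surplus `m e₁`.
  by_cases hcase : x - 1 ≤ N / 2
  · have h1 : x * (m + e₁) ≤ x * m + N * e₁ := by nlinarith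
    have h2 : (x - 1) * (m + 2 + e₂) ≤ (x - 2) * (m + 2) + N * e₂ := by
      have h3 : m + 2 ≤ N / 2 * e₂ := by
        calc m + 2 ≤ N / 2 * (e * (m + 2)) := by nlinarith
          _ ≤ _ := by gcongr
      have h4 : (x - 1) * e₂ ≤ N / 2 * e₂ := by gcongr
      nlinarith
    calc x * (x - 1) * ((m + e₁) * (m + 2 + e₂)) = (x * (m + e₁)) * ((x - 1) * (m + 2 + e₂)) := by
          ring
      _ ≤ _ := by
          apply mul_le_mul h1 h2 (by positivity)
          positivity
  · push Not at hcase
    have h1 : x * (m + e₁) + m * e₁ ≤ x * m + N * e₁ := by nlinarith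
    have h2 : (x - 1) * (m + 2 + e₂) + ((m + 1) * e₂ - (m + 2)) ≤
        (x - 2) * (m + 2) + N * e₂ := by nlinarith
    have h3 : -(1 + m / 50) ≤ (m + 1) * e₂ - (m + 2) := by nlinarith
    have h4 : 0 ≤ (x - 1) * (m + 2 + e₂) + ((m + 1) * e₂ - (m + 2)) := by nlinarith
    -- The surplus outweighs the deficit; the constants use `x > 11`, which follows from `x - 1 >
    -- N/2 ≥ 10`.
    have h5 : (1 + m / 50) * (x * (m + e₁) + m * e₁) ≤ m * e₁ * ((x - 1) * (m + 2 + e₂)) := by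
      have p1 : 0 ≤ x * m := by positivity
      have k1 : x * m * (99 / 100) ≤ x * m * e₁ := by gcongr
      have k2 : x * e₁ ≤ x * m * e₁ := by
        have : 0 ≤ x * e₁ := by positivity
        nlinarith
      have k3 : 10 * (m * e₁) ≤ x * m * e₁ := by
        have : 0 ≤ m * e₁ := by positivity
        nlinarith
      have k4 : x * (m + e₁) + m * e₁ ≤ 22 / 10 * (x * m * e₁) := by nlinarith
      have k5 : 9 / 10 * x ≤ x - 1 := by linarith
      calc (1 + m / 50) * (x * (m + e₁) + m * e₁)
          ≤ (1 + m / 50) * (22 / 10 * (x * m * e₁)) := by gcongr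
        _ = (x * m * e₁) * (22 / 10 * (1 + m / 50)) := by ring
        _ ≤ (x * m * e₁) * (9 / 10 * (m + 2 + e₂)) := by
            refine mul_le_mul_of_nonneg_left ?_ (by positivity)
            linarith
        _ = m * e₁ * ((9 / 10 * x) * (m + 2 + e₂)) := by ring
        _ ≤ _ := by gcongr
    have h6 : 0 ≤ x * (m + e₁) + m * e₁ := by positivity
    calc x * (x - 1) * ((m + e₁) * (m + 2 + e₂))
        ≤ (x * (m + e₁) + m * e₁) * ((x - 1) * (m + 2 + e₂) + ((m + 1) * e₂ - (m + 2))) := by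
          nlinarith [mul_le_mul_of_nonneg_left h3 h6]
      _ ≤ _ := mul_le_mul h1 h2 h4 (h6.trans h1)

/-- Since `b` and `1 - c` are nonnegative, `denom` increases with `M`, so `M` may be replaced by `m
+ 2`. After adding `ε²` the rest is an identity: with `D = shift ε`, the right side is `((m+2)(1+ε)
- D)² - (1+ε)²`. -/
theorem denom_le {ε m M : ℝ} (h0 : 0 < ε) (hε : ε ≤ 1 / 10 ^ 8) (hm : 0 ≤ m) (hM : 0 < M)
    (hMm : M ≤ m + 2) :
    (m + 2) ^ 2 * denom ε M ≤ (m + (ε * m + (1 + ε - shift ε))) *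
      (m + 2 + (ε * (m + 2) + (1 + ε - shift ε))) := by
  have hb : 0 ≤ bSeq ε := by
    have := Real.sqrt_pos.2 h0
    linarith [(bSeq_bounds h0 hε).1]
  have hc := (one_sub_cSeq_bounds h0 hε).1
  have hp : 0 < m + 2 := by linarith
  have h1 : 2 * bSeq ε / (m + 2) ≤ 2 * bSeq ε / M := by gcongr
  have h2 : (1 - cSeq ε) / (m + 2) ^ 2 ≤ (1 - cSeq ε) / M ^ 2 := by gcongr
  calc (m + 2) ^ 2 * denom ε M
      ≤ (m + 2) ^ 2 * (1 + 2 * ε + ε ^ 2 - 2 * bSeq ε / (m + 2) - (1 - cSeq ε) / (m + 2) ^ 2) := by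
        gcongr
        rw [denom]
        nlinarith [sq_nonneg ε]
    _ = (m + 2) ^ 2 * (1 + 2 * ε + ε ^ 2) - 2 * bSeq ε * (m + 2) - (1 - cSeq ε) := by
        field_simp
    _ = _ := by
        rw [bSeq_eq (by linarith), one_sub_cSeq h0.le (by linarith)]
        ring

namespace ThreeModes

variable {d : ℕ} (S : ThreeModes d)

theorem eps_pos : 0 < S.eps := by
  refine div_pos ?_ S.phi_pos
  obtain ⟨r, hr⟩ := Function.ne_iff.1 S.j_ne_zero
  refine Finset.sum_pos' (fun _ _ => sq_nonneg _) ⟨r, Finset.mem_univ r, ?_⟩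
  have h1 : (S.j r : ℝ) ≠ 0 := by exact_mod_cast hr
  have h2 := S.L_pos
  have h3 := Real.pi_pos
  positivity

theorem ksq_eq : S.ksq S.j = S.phi * S.eps := by
  rw [eps, mul_div_cancel₀ _ S.phi_pos.ne']

theorem EBog_eq : S.EBog = -(S.phi * (1 + S.eps - Real.sqrt (S.eps ^ 2 + 2 * S.eps))) := by
  have h1 : (S.phi * S.eps) ^ 2 + 2 * S.phi * (S.phi * S.eps) =
      S.phi ^ 2 * (S.eps ^ 2 + 2 * S.eps) := by ring
  rw [EBog, ksq_eq, h1, Real.sqrt_mul (sq_nonneg _), Real.sqrt_sq S.phi_pos.le]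
  ring

theorem zero_add_pairCount_le (n : Config d S.N) : n.1 0 + S.pairCount n ≤ S.N := by
  have h1 : (-S.j) ≠ 0 := neg_ne_zero.2 S.j_ne_zero
  have h2 : Finsupp.single 0 (n.1 0) + (Finsupp.single S.j (n.1 S.j) +
      Finsupp.single (-S.j) (n.1 (-S.j))) ≤ n.1 := by
    intro l
    simp only [Finsupp.add_apply, Finsupp.single_apply]
    have := S.neg_j_ne_j
    have := S.j_ne_zero
    split_ifs <;> subst_vars <;> simp_all
  have h3 := Finsupp.degree_mono h2
  rw [n.2] at h3
  simpa [pairCount] using h3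

theorem le_energy (n : Config d S.N) :
    S.phi * (S.eps + n.1 0 / S.N) * S.pairCount n ≤ S.energy n := by
  rw [energy, ksq_eq]
  have h := S.kin_nonneg n
  calc S.phi * (S.eps + n.1 0 / S.N) * S.pairCount n =
      0 + (S.phi * S.eps + S.phi / S.N * n.1 0) * S.pairCount n := by ring
    _ ≤ _ := by gcongr

theorem rho_le_of_le_energy {z E : ℝ} (i : ℕ) (n : Config d S.N) (hE : 0 < E)
    (h : E ≤ S.energy n - z) : S.rho z i n ≤ E⁻¹ := by
  have h1 : (S.energy n - z)⁻¹ ≤ E⁻¹ := inv_anti₀ hE h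
  have h2 : 0 ≤ (S.energy n - z)⁻¹ := inv_nonneg.2 (hE.le.trans h)
  calc S.rho z i n ≤ 1 * (S.energy n - z)⁻¹ :=
        mul_le_mul_of_nonneg_right (S.qInd_le_one i n) h2
    _ ≤ _ := by rwa [one_mul]

variable {S} {z : ℝ}

/-- With `m` particles in ±j, `(n_j + 1)(n_{-j} + 1) ≤ (m+2)²/4`, which produces the 4. Then
`sector_product_le` and `denom_le` combine, all powers of `φ/N` cancelling. -/
theorem coefW_sq_mul_rho_le (hε : S.eps ≤ 1 / 10 ^ 8) (hNe : 2 ≤ S.N * S.eps)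
    (hz : z ≤ -(S.phi * (1 + S.eps - shift S.eps))) (s : ℕ) (hs : 2 * (s + 1) + 2 ≤ S.N)
    (n : Config d S.N) :
    S.coefW n ^ 2 * S.rho z (2 * s) (S.up n) * S.rho z (2 * s + 2) n ≤
      1 / (4 * denom S.eps ((S.N : ℝ) - 2 * s - 1)) := by
  have h0 := S.eps_pos
  have hφ := S.phi_pos
  obtain ⟨-, hD⟩ := shift_bounds h0 hε
  have hw' := sqrt_le_of_le hε
  have hζ : 99 / 100 ≤ 1 + S.eps - shift S.eps := by linarith
  have hNs : (2 : ℝ) * s + 4 ≤ S.N := by exact_mod_cast (by omega : 2 * s + 4 ≤ S.N)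
  have hA := denom_pos h0 hε (M := (S.N : ℝ) - 2 * s - 1) (by linarith)
  have hrhs : 0 ≤ 1 / (4 * denom S.eps ((S.N : ℝ) - 2 * s - 1)) := by positivity
  by_cases hx : 2 ≤ n.1 0
  swap
  · rw [S.coefW_eq_zero hx]
    simpa using hrhs
  by_cases hq : S.pairCount n + (2 * s + 2) = S.N ∨ S.pairCount n + (2 * s + 2 + 1) = S.N
  swap
  · rw [rho, rho, qInd, qInd, if_neg hq]
    simpa using hrhs
  have hdeg := S.zero_add_pairCount_le n
  have hup := S.pairCount_up hx
  have hup0 := S.up_zero hx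
  have hN0 : (0 : ℝ) < S.N := by
    have : 0 ≤ (s : ℝ) := Nat.cast_nonneg s
    linarith
  have hN20 : (20 : ℝ) ≤ S.N := by
    have : (S.N : ℝ) * S.eps ≤ S.N * (1 / 10 ^ 8) := by gcongr
    linarith
  have hE1 := S.le_energy n
  have hE2 := S.le_energy (S.up n)
  have hup0' : ((S.up n).1 0 : ℝ) = (n.1 0 : ℝ) - 2 := by
    rw [← hup0]; push_cast; ring
  rw [hup, hup0'] at hE2
  push_cast at hE2
  have hpq : ((n.1 S.j : ℝ) + 1) * (n.1 (-S.j) + 1) ≤ ((S.pairCount n : ℝ) + 2) ^ 2 / 4 := by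
    rw [pairCount]
    push_cast
    linarith [sq_nonneg ((n.1 S.j : ℝ) - n.1 (-S.j))]
  have hm1 : 1 ≤ (S.pairCount n : ℝ) := by
    exact_mod_cast (by omega : 1 ≤ S.pairCount n)
  have hxm : (n.1 0 : ℝ) + S.pairCount n ≤ S.N := by exact_mod_cast hdeg
  have hx2 : (2 : ℝ) ≤ n.1 0 := by exact_mod_cast hx
  -- The block allows `m + 2` to be `N - 2s` or `N - 2s - 1`; `denom` is taken at the smaller value.
  have hM : (S.N : ℝ) - 2 * s - 1 ≤ S.pairCount n + 2 := by
    have : S.N ≤ S.pairCount n + 2 + 2 * s + 1 := by omega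
    have : (S.N : ℝ) ≤ S.pairCount n + 2 + 2 * s + 1 := by exact_mod_cast this
    linarith
  have hprod := sector_product_le hx2 hm1 hxm h0.le hζ hNe hN20
  have hden := denom_le h0 hε (by linarith) (by linarith) hM
  have hW := S.coefW_sq n
  have hr1 := S.rho_le_of_le_energy (z := z) (2 * s + 2) n
    (E := S.phi / S.N * (n.1 0 * S.pairCount n +
      S.N * (S.eps * S.pairCount n + (1 + S.eps - shift S.eps))))
  have hr2 := S.rho_le_of_le_energy (z := z) (2 * s) (S.up n)
    (E := S.phi / S.N * ((n.1 0 - 2) * (S.pairCount n + 2) +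
      S.N * (S.eps * (S.pairCount n + 2) + (1 + S.eps - shift S.eps))))
  have hz0 : z < 0 := by
    have : 0 < S.phi * (1 + S.eps - shift S.eps) := mul_pos hφ (by linarith)
    linarith
  have hρ1 := rho_nonneg hz0 (2 * s + 2) n
  have hρ2 := rho_nonneg hz0 (2 * s) (S.up n)
  generalize (n.1 S.j : ℝ) = p₁ at *
  generalize (n.1 (-S.j) : ℝ) = p₂ at *
  generalize S.rho z (2 * s + 2) n = ρ₁ at *
  generalize S.rho z (2 * s) (S.up n) = ρ₂ at *
  generalize (n.1 0 : ℝ) = x at *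
  generalize (S.pairCount n : ℝ) = m at *
  generalize denom S.eps ((S.N : ℝ) - 2 * s - 1) = A at *
  generalize 1 + S.eps - shift S.eps = ζ at *
  have hN0' : (S.N : ℝ) ≠ 0 := hN0.ne'
  have hζ0 : 0 < ζ := by linarith
  have hF1 : 0 < x * m + S.N * (S.eps * m + ζ) := by positivity
  have hF2 : 0 < (x - 2) * (m + 2) + S.N * (S.eps * (m + 2) + ζ) := by
    have : 0 ≤ (x - 2) * (m + 2) := mul_nonneg (by linarith) (by linarith)
    positivity
  have hr1 := hr1 (by positivity) (by
    have : S.phi / S.N * (x * m + S.N * (S.eps * m + ζ)) =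
      S.phi * (S.eps + x / S.N) * m + S.phi * ζ := by
      field_simp
      ring
    linarith)
  have hr2 := hr2 (by positivity) (by
    have : S.phi / S.N * ((x - 2) * (m + 2) + S.N * (S.eps * (m + 2) + ζ)) =
      S.phi * (S.eps + (x - 2) / S.N) * (m + 2) + S.phi * ζ := by
      field_simp
      ring
    linarith)
  generalize x * m + S.N * (S.eps * m + ζ) = F₁ at *
  generalize (x - 2) * (m + 2) + S.N * (S.eps * (m + 2) + ζ) = F₂ at *
  have hxx : 0 ≤ x * (x - 1) := mul_nonneg (by linarith) (by linarith)
  have key : x * (x - 1) * (m + 2) ^ 2 * A ≤ F₁ * F₂ := by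
    calc x * (x - 1) * (m + 2) ^ 2 * A = x * (x - 1) * ((m + 2) ^ 2 * A) := by ring
      _ ≤ _ := (mul_le_mul_of_nonneg_left hden hxx).trans hprod
  rw [hW]
  have hc : x * (x - 1) * (p₁ + 1) * (p₂ + 1) ≤ x * (x - 1) * ((m + 2) ^ 2 / 4) := by
    rw [mul_assoc]
    gcongr
  calc (S.phi / S.N) ^ 2 * (x * (x - 1) * (p₁ + 1) * (p₂ + 1)) * ρ₂ * ρ₁
      ≤ (S.phi / S.N) ^ 2 * (x * (x - 1) * ((m + 2) ^ 2 / 4)) *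
          (S.phi / S.N * F₂)⁻¹ * (S.phi / S.N * F₁)⁻¹ := by
        gcongr
    _ = x * (x - 1) * (m + 2) ^ 2 / (4 * (F₁ * F₂)) := by
        field_simp
    _ ≤ _ := by
        rw [div_le_div_iff₀ (by positivity) (by positivity)]
        linarith

theorem flowBound (hε : S.eps ≤ 1 / 10 ^ 8) (hNe : 2 ≤ S.N * S.eps)
    (hz : z ≤ -(S.phi * (1 + S.eps - shift S.eps))) (hz0 : z < 0) :
    S.FlowBound z (XSeq (2 * S.eps) S.eps S.N) where
  neg := hz0
  zero := rfl
  pos s hs := XSeq_pos S.eps_pos hε hs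
  step s n hs := by
    refine (coefW_sq_mul_rho_le hε hNe hz s hs n).trans (le_of_eq ?_)
    have hX := XSeq_pos S.eps_pos hε (N := S.N) (s := s) (by omega)
    have hNs : (2 : ℝ) * s + 4 ≤ S.N := by exact_mod_cast (by omega : 2 * s + 4 ≤ S.N)
    have hA := denom_pos S.eps_pos hε (M := (S.N : ℝ) - 2 * s - 1) (by linarith)
    rw [XSeq_succ]
    field_simp
    ring

end ThreeModes

/-- The bound on `1/N` is needed only in the form `N ε ≥ 2`: compare with the exponent 5/4 and use
`ε^{1/4} ≤ 1/2`. -/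
theorem two_le_mul_of_inv_le_rpow {ε ν N : ℝ} (h0 : 0 < ε) (hε : ε ≤ 1 / 10 ^ 8)
    (hν : 11 / 8 < ν) (hN : 0 < N) (h : 1 / N ≤ ε ^ ν) : 2 ≤ N * ε := by
  have h1 : ε ^ ν ≤ ε ^ (1 + 1 / 4 : ℝ) :=
    Real.rpow_le_rpow_of_exponent_ge h0 (by linarith) (by linarith)
  rw [Real.rpow_add h0, Real.rpow_one] at h1
  have h2 : ε ^ (1 / 4 : ℝ) ≤ 1 / 2 := by
    have h3 : (ε ^ (1 / 4 : ℝ)) ^ 4 = ε := by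
      rw [← Real.rpow_natCast, ← Real.rpow_mul h0.le]
      norm_num
    refine le_of_pow_le_pow_left₀ (n := 4) (by norm_num) (by norm_num) ?_
    rw [h3]
    linarith
  have h3 : 1 / N ≤ ε * (1 / 2) := h.trans (h1.trans (by gcongr))
  rw [div_le_iff₀ hN] at h3
  linarith

end Bogoliubov

end

theorem mainTheorem3 (ν : ℝ) (hν : 11 / 8 < ν) :
    ∃ a : ℝ → ℝ, (fun ε => a ε - 2 * ε) =O[𝓝[>] 0] (fun ε => ε ^ ν) ∧
    ∃ r : ℝ → ℝ, Tendsto r (𝓝[>] 0) (𝓝 0) ∧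
    ∃ ε₀ : ℝ, 0 < ε₀ ∧
      ∀ (d : ℕ) (S : Bogoliubov.ThreeModes d) (z : ℝ),
        S.eps ≤ ε₀ →
        1 / (S.N : ℝ) ≤ S.eps ^ ν →
        z ≤ S.EBog + Real.sqrt S.eps * S.phi * Real.sqrt (S.eps ^ 2 + 2 * S.eps) →
        z < 0 ∧
        ∀ s : ℕ, 2 * s + 2 ≤ S.N →
          -- the resolvents are well defined and nonnegative
          Bogoliubov.BlockInvertible (S.Q (2 * s)) (S.HSub z) ∧
          0 ≤ S.R z (2 * s) ∧
          -- the Feshbach-Schur step is well defined and yields a self-adjoint operator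
          Bogoliubov.BlockInvertible (S.Q (2 * s)) (S.KPrev z s) ∧
          (S.K z s).domain = (Bogoliubov.sandwich (S.QGt (2 * s)) (S.HSub z)).domain ∧
          IsSelfAdjoint (S.K z s) ∧
          -- the formula for the first step
          (s = 0 →
            S.K z 0 = Bogoliubov.sandwich (S.QGt 0) (S.HSub z) -
              Bogoliubov.toP (S.QGt 0 * S.W * S.R z 0 * S.Wstar * S.QGt 0)) ∧
          -- the convergent Neumann expansions and the formula for the later steps
          (1 ≤ s →
            Summable (fun l : ℕ => (S.Gam z s * S.R z (2 * s)) ^ l) ∧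
            Summable (fun l : ℕ => (S.GamSym z s) ^ l) ∧
            S.K z s = Bogoliubov.sandwich (S.QGt (2 * s)) (S.HSub z) -
              Bogoliubov.toP (S.QGt (2 * s) * S.W * S.R z (2 * s) *
                (∑' l : ℕ, (S.Gam z s * S.R z (2 * s)) ^ l) * S.Wstar * S.QGt (2 * s))) ∧
          -- the symmetric form of the effective interactions
          (2 ≤ s →
            S.Gam z s = S.Wblock (2 * s) (2 * (s - 1)) * S.Rsqrt z (2 * (s - 1)) *
              (∑' l : ℕ, (S.GamSym z (s - 1)) ^ l) *
              S.Rsqrt z (2 * (s - 1)) * S.Wstarblock (2 * (s - 1)) (2 * s)) ∧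
          -- the bound through the auxiliary sequence
          0 < Bogoliubov.XSeq (a S.eps) S.eps S.N s ∧
          ‖S.GamCheck z s‖ ≤ 1 / Bogoliubov.XSeq (a S.eps) S.eps S.N s ∧
          1 / 4 + r S.eps ≤ Bogoliubov.XSeq (a S.eps) S.eps S.N s := by
  -- The error term in `a` can be zero. The threshold `10⁻⁸` gives `√ε ≤ 10⁻⁴` and `ε^{1/4} ≤
  -- 1/100`.
  refine ⟨fun ε => 2 * ε, by simpa using isBigO_zero _ _, Bogoliubov.remainder,
    Bogoliubov.tendsto_remainder, 1 / 10 ^ 8, by norm_num, fun d S z hε hN hz => ?_⟩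
  have h0 := S.eps_pos
  have hz' : z ≤ -(S.phi * (1 + S.eps - Bogoliubov.shift S.eps)) := by
    rw [S.EBog_eq] at hz
    refine hz.trans (le_of_eq ?_)
    rw [Bogoliubov.shift]
    ring
  have hz0 : z < 0 := by
    obtain ⟨-, hD⟩ := Bogoliubov.shift_bounds h0 hε
    have hw' := Bogoliubov.sqrt_le_of_le hε
    have : 0 < S.phi * (1 + S.eps - Bogoliubov.shift S.eps) :=
      mul_pos S.phi_pos (by linarith)
    linarith
  refine ⟨hz0, fun s hs => ?_⟩
  have hNpos : (0 : ℝ) < S.N := by exact_mod_cast (by omega : 0 < S.N)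
  have hNe := Bogoliubov.two_le_mul_of_inv_le_rpow h0 hε hν hNpos hN
  have hX := Bogoliubov.ThreeModes.flowBound hε hNe hz' hz0
  have hK := hX.K_eq s hs
  refine ⟨S.blockInvertible_HSub hz0 _, (S.isDiag_R hz0 _).nonneg
    (Bogoliubov.ThreeModes.rho_nonneg hz0 _), (hX.flow s hs).1, hX.K_domain s hs,
    hX.K_selfAdjoint s hs, ?_, fun _ => ⟨hX.summable_Gam s hs, hX.summable_GamSym s hs, ?_⟩,
    fun h2 => hX.Gam_eq_symmetric s h2 hs, hX.pos s hs, hX.norm_GamCheck_le s hs,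
    Bogoliubov.remainder_le_XSeq h0 hε hs⟩
  · rintro rfl
    rw [hK, S.resummed_zero]
  · rw [hK, Bogoliubov.ThreeModes.resummed, ← mul_assoc]
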